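/- Let $T=((\Delta_i,o_i)_{i\in I},\Phi)$ be an abstract triangulation: a finite family of oriented simplicial tetrahedra with an orientation-reversing perfect matching $\Phi$ of their faces (no face is matched with itself). Let $\mathrm{Tr}(T)$ be the space obtained from the tetrahedra truncated around their vertices by gluing the hexagonal faces according to $\Phi$; its boundary is the union of the remaining triangular faces. Let $M$ be a space with boundary $\partial M$ together with a homeomorphism $\mathrm{Tr}(T)\to M$ carrying boundary to boundary, and let $b$ be a branching of $T$, i.e. an orientation of the edges of the glued complex that on every tetrahedron is induced by an ordering $<$ of its vertices. **The set $\mathcal R(M)$.** Its elements are equivalence classes of triples $(P,s,l)$, where * $P$ is a flat $\mathrm{PSL}(2,\mathbb C)$-bundle over $M$ (a homomorphism from the fundamental groupoid of $M$ to $\mathrm{PSL}(2,\mathbb C)$) that lifts to a flat $\mathrm{SL}(2,\mathbb C)$-bundle; * $s$ is a flat section over $\partial M$ of the associated $\mathbb CP^1$-bundle; * $l$ assigns to every loop $\gamma$ in $\partial M$ a number $l(\gamma)\in\mathbb C$, depending only on the free homotopy class of $\gamma$ in $\partial M$, with $l(\gamma\delta)=l(\gamma)+l(\delta)$ for loops with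 the same base point, and such that, for some flat $\mathrm{SL}(2,\mathbb C)$-lift of $P$ (the same lift for all loops), $\exp(l(\gamma))$ is the holonomy along $\gamma$ of the tautological line bundle lying over $s$ in the associated $\mathbb C^2$-bundle. Two triples are equivalent if some isomorphism of the flat $\mathrm{PSL}(2,\mathbb C)$-bundles carries one section to the other and the two functions $l$ agree. An arc $\gamma$ in $M$ with ends in $\partial M$ is *regular* with respect to $(P,s,l)$ if the holonomy along $\gamma$ sends the value of $s$ at the source of $\gamma$ to a point different from the value of $s$ at the target. **Combinatorial data.** Write $xyzt$ for an ordering of the vertices of one of the tetrahedra. A *cross-ratio structure* is a map $X$ from the set of these orderings to $\mathbb C\setminus\{0,1\}$ with $$X(xyzt)=X(ztxy)=X(yxzt)^{-1}=X(xytz)^{-1},\qquad X(xzty)=\frac1{1-X(xyzt)},$$ and $\prod_i X(xyz_iz_{i+1})=1$ for every oriented edge $e$ of the glued complex, where $xyz_iz_{i+1}$ runs cyclically through the tetrahedra around $e$ and $xy$ projects to $e$. A *flattening* associated to $X$ and $b$ is a map $L$ from the set of orderings to $\mathbb C$ with $$L(xyzt)=-L(yxzt)=-L(xytz),\qquad \exp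 L(xyzt)=X(xyzt),$$ $$L(xyzt)+L(xzty)+L(xtyz)=i\pi\ \text{ whenever } y<z<t,$$ and $\sum_i L(xyz_iz_{i+1})=0$ around every edge. **The element $\phi(X,L)$.** Let $P(T)$ be the polyhedral subdivision obtained by truncating vertices and edges. Its vertices are given by the orderings $xyzt$, those of glued tetrahedra that agree on a common face $xyz$ being identified; the vertex $xyzt$ is realized in $\mathrm{Tr}(T)$ on the triangle around $x$, on its side contained in the face $xyz$, nearer to the edge $xy$ than to the edge $xz$. Its edges join $xyzt$ to $yxzt$, to $xzyt$ and to $xytz$; the last two kinds lie in the boundary. Then $\phi(X,L)\in\mathcal R(M)$ is the class of the triple with $s=\infty=[1:0]$ at the vertices of $P(T)$, with holonomy in $\mathrm{PSL}(2,\mathbb C)=\mathrm{GL}(2,\mathbb C)/\mathbb C^*$ given by $$\begin{pmatrix}0&1\\1&0\end{pmatrix},\qquad \begin{pmatrix}1&-1\\0&-1\end{pmatrix},\qquad \begin{pmatrix}1&0\\0&X(xyzt)\end{pmatrix}$$ along the edges from $xyzt$ to $yxzt$, $xzyt$ and $xytz$ respectively, and with $l(\gamma)$, for a closed edge path $\gamma$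 of $P(T)$ in the boundary, equal to the sum over its edges of $-\tfrac12L(xyzt)$ for an edge from $xyzt$ to $xytz$, and of $-\tfrac{i\pi}2$ if $y<z$, respectively $+\tfrac{i\pi}2$ if $z<y$, for an edge from $xyzt$ to $xzyt$. **Proposition.** Let $(P,s,l)\in\mathcal R(M)$ be such that every edge of $\mathrm{Tr}(T)$ that does not lie on the boundary (one for each edge of each tetrahedron) is regular with respect to $(P,s,l)$. Then there are a cross-ratio structure $X$ on $T$ and a flattening $L$ associated to $X$ and $b$ such that $\phi(X,L)=(P,s,l)$. -/

import Mathlib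

open Equiv
open scoped LinearAlgebra.Projectivization

noncomputable section

/-! ## Abstract triangulations and their truncated realization -/

/-- An abstract triangulation: oriented simplicial tetrahedra `Δ i` (`i : I`), each with vertex set
`Fin 4`, and an orientation reversing matching of their faces. The face of `Δ i` opposite to the
vertex `f` is matched with the face of `Δ (nbr i f)` opposite to the vertex `glue i f f`; a vertex
`v ≠ f` of the first face is sent to the vertex `glue i f v` of the second one.
`orient i = 1` means that the ordering `0123` of `Δ i` is positive. -/
structure AbstractTriangulation (I : Type*) where
  orient : I → ℤˣ
  nbr : I → Fin 4 → I
  glue : I → Fin 4 → Perm (Fin 4)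
  nbr_nbr : ∀ i f, nbr (nbr i f) (glue i f f) = i
  glue_glue : ∀ i f, glue (nbr i f) (glue i f f) = (glue i f)⁻¹
  not_self : ∀ i f, (nbr i f, glue i f f) ≠ (i, f)
  reversing : ∀ i f, Perm.sign (glue i f) * orient i * orient (nbr i f) = -1

/-- The tetrahedron truncated around its vertices, in barycentric coordinates. -/
def truncTet : Set (Fin 4 → ℝ) :=
  {p | (∀ v, 0 ≤ p v) ∧ ∑ v, p v = 1 ∧ ∀ v, p v ≤ 2 / 3}

/-- The vertex `xy` of the truncated tetrahedron (near `x`, on the edge from `x` to `y`). -/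
def truncVertex (x y : Fin 4) (hxy : x ≠ y) : truncTet :=
  ⟨fun v => if v = x then 2 / 3 else if v = y then 1 / 3 else 0, by
    refine ⟨fun v => ?_, ?_, fun v => ?_⟩
    · dsimp only
      split_ifs <;> norm_num
    · fin_cases x <;> fin_cases y <;> first | exact absurd rfl hxy | (simp [Fin.sum_univ_four]; norm_num)
    · dsimp only
      split_ifs <;> norm_num⟩

/-- The vertex `xyzt` of the polyhedron `P(Δ)`, where `(x, y, z, t) = (σ 0, σ 1, σ 2, σ 3)`. It is
placed in the truncated tetrahedron on the triangle around `x`, on the side of that triangle that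
lies in the face `xyz`, and closer to the edge `xy` than to the edge `xz`. -/
def polyVertex (σ : Perm (Fin 4)) : truncTet :=
  ⟨fun v => (![2 / 3, 2 / 9, 1 / 9, 0] : Fin 4 → ℝ) (σ.symm v), by
    have key : ∀ k : Fin 4, 0 ≤ (![2 / 3, 2 / 9, 1 / 9, 0] : Fin 4 → ℝ) k ∧
        (![2 / 3, 2 / 9, 1 / 9, 0] : Fin 4 → ℝ) k ≤ 2 / 3 := by
      intro k
      fin_cases k <;> norm_num
    refine ⟨fun v => (key _).1, ?_, fun v => (key _).2⟩
    rw [Equiv.sum_comp σ.symm (![2 / 3, 2 / 9, 1 / 9, 0] : Fin 4 → ℝ)]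
    simp [Fin.sum_univ_four]
    norm_num⟩

theorem polyVertex_apply_zero (σ : Perm (Fin 4)) : (polyVertex σ).1 (σ 0) = 2 / 3 := by
  simp [polyVertex]

theorem convex_truncTet : Convex ℝ truncTet := by
  intro p hp q hq a b ha hb hab
  obtain ⟨hp0, hp1, hp2⟩ := hp
  obtain ⟨hq0, hq1, hq2⟩ := hq
  refine ⟨fun v => ?_, ?_, fun v => ?_⟩
  · have := mul_nonneg ha (hp0 v)
    have := mul_nonneg hb (hq0 v)
    simp only [Pi.add_apply, Pi.smul_apply, smul_eq_mul]
    linarith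
  · simp only [Pi.add_apply, Pi.smul_apply, smul_eq_mul, Finset.sum_add_distrib,
      ← Finset.mul_sum, hp1, hq1]
    linarith
  · have := mul_le_mul_of_nonneg_left (hp2 v) ha
    have := mul_le_mul_of_nonneg_left (hq2 v) hb
    simp only [Pi.add_apply, Pi.smul_apply, smul_eq_mul]
    nlinarith

/-- The straight segment between two points of the truncated tetrahedron. -/
def segPath (p q : truncTet) : Path p q where
  toFun t := ⟨AffineMap.lineMap p.1 q.1 (t : ℝ),
    convex_truncTet.lineMap_mem p.2 q.2 t.2⟩
  continuous_toFun := by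
    refine Continuous.subtype_mk ?_ _
    simp only [AffineMap.lineMap_apply_module]
    fun_prop
  source' := by ext1; simp
  target' := by ext1; simp

theorem segPath_apply_eq {p q : truncTet} {x : Fin 4} (hp : p.1 x = 2 / 3) (hq : q.1 x = 2 / 3)
    (t : unitInterval) : (segPath p q t).1 x = 2 / 3 := by
  change (AffineMap.lineMap p.1 q.1 (t : ℝ) : Fin 4 → ℝ) x = 2 / 3
  simp only [AffineMap.lineMap_apply_module, Pi.add_apply, Pi.smul_apply, smul_eq_mul, hp, hq]
  ring

namespace AbstractTriangulation

variable {I : Type*} (T : AbstractTriangulation I)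

/-- The identification of the points of the matched hexagonal faces. -/
def Glued (a b : Σ _ : I, truncTet) : Prop :=
  ∃ f : Fin 4, a.2.1 f = 0 ∧ b.1 = T.nbr a.1 f ∧ ∀ v, b.2.1 (T.glue a.1 f v) = a.2.1 v

/-- The truncated triangulation `tru(T)`, with the quotient topology. -/
abbrev Trunc : Type _ := Quot T.Glued

/-- The point of `tru(T)` given by a point of a truncated tetrahedron. -/
def pt (i : I) (p : truncTet) : T.Trunc := Quot.mk _ ⟨i, p⟩

theorem continuous_pt (i : I) : Continuous (T.pt i) :=
  continuous_quot_mk.comp continuous_sigmaMk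

/-- The boundary of `tru(T)`: the union of the triangles. -/
def boundary : Set T.Trunc := {m | ∃ (i : I) (p : truncTet) (x : Fin 4), p.1 x = 2 / 3 ∧ T.pt i p = m}

/-- An ordered simplicial tetrahedron `xyzt` of the triangulation: `(i, σ)` is the tetrahedron `Δ i`
with the ordering `σ 0, σ 1, σ 2, σ 3` of its vertices. -/
abbrev _root_.OrderedTet (I : Type*) : Type _ := I × Perm (Fin 4)

end AbstractTriangulation

namespace OrderedTet

variable {I : Type*}

/-- `xyzt ↦ yxzt` -/
def swap₁ (o : OrderedTet I) : OrderedTet I := (o.1, o.2 * swap 0 1)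

/-- `xyzt ↦ xzyt` -/
def swap₂ (o : OrderedTet I) : OrderedTet I := (o.1, o.2 * swap 1 2)

/-- `xyzt ↦ xytz` -/
def swap₃ (o : OrderedTet I) : OrderedTet I := (o.1, o.2 * swap 2 3)

/-- `xyzt ↦ ztxy` -/
def opp (o : OrderedTet I) : OrderedTet I := (o.1, o.2 * (swap 0 2 * swap 1 3))

/-- `xyzt ↦ xzty` -/
def rot (o : OrderedTet I) : OrderedTet I := (o.1, o.2 * (swap 1 2 * swap 2 3))

end OrderedTet

namespace AbstractTriangulation

variable {I : Type*} (T : AbstractTriangulation I)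

/-- Turning around the oriented edge `xy`: `xyzt` is sent to `xytu`, where `xytu` is the tetrahedron
glued to the tetrahedron `xyzt` along the face `xyt`, and `u` is its remaining vertex. The orbit of
`xyzt` describes the star `v(e)` of the edge `e` of `S(T)` that `xy` projects to. -/
def next (o : OrderedTet I) : OrderedTet I :=
  (T.nbr o.1 (o.2 2), T.glue o.1 (o.2 2) * o.2 * swap 2 3)

/-- The number of tetrahedra around the edge `xy` of `xyzt`. -/
def valence (o : OrderedTet I) : ℕ := Function.minimalPeriod T.next o

/-- A branching: an ordering of the vertices of every tetrahedron (`rank i v` is the position of the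
vertex `v` of `Δ i`), such that the induced orientations of the edges are compatible with the
matching of the faces. -/
structure Branching where
  rank : I → Perm (Fin 4)
  compat : ∀ i f x y, x ≠ f → y ≠ f →
    (rank i x < rank i y ↔ rank (T.nbr i f) (T.glue i f x) < rank (T.nbr i f) (T.glue i f y))

/-- A cross-ratio structure. -/
structure CrossRatioStructure where
  X : OrderedTet I → ℂ
  ne_zero : ∀ o, X o ≠ 0
  ne_one : ∀ o, X o ≠ 1
  X_opp : ∀ o, X o = X o.opp
  X_swap₁ : ∀ o, X o = (X o.swap₁)⁻¹
  X_swap₃ : ∀ o, X o = (X o.swap₃)⁻¹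
  X_rot : ∀ o, X o.rot = 1 / (1 - X o)
  X_edge : ∀ o, ∏ k ∈ Finset.range (T.valence o), X (T.next^[k] o) = 1

/-- A flattening associated to a cross-ratio structure and a branching. -/
structure Flattening (b : T.Branching) (X : T.CrossRatioStructure) where
  L : OrderedTet I → ℂ
  L_swap₁ : ∀ o, L o = -L o.swap₁
  L_swap₃ : ∀ o, L o = -L o.swap₃
  L_rot : ∀ o : OrderedTet I, b.rank o.1 (o.2 1) < b.rank o.1 (o.2 2) →
    b.rank o.1 (o.2 2) < b.rank o.1 (o.2 3) → L o + L o.rot + L o.rot.rot = Complex.I * Real.pi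
  exp_L : ∀ o, Complex.exp (L o) = X.X o
  L_edge : ∀ o, ∑ k ∈ Finset.range (T.valence o), L (T.next^[k] o) = 0

end AbstractTriangulation

/-! ## The set `R(M)` -/

/-- The group `SL(2, ℂ)`. -/
abbrev SL2C : Type := Matrix.SpecialLinearGroup (Fin 2) ℂ

/-- The group `PSL(2, ℂ)`. -/
abbrev PSL2C : Type := Matrix.ProjectiveSpecialLinearGroup (Fin 2) ℂ

/-- The complex projective line. -/
abbrev CP1 : Type := ℙ ℂ (Fin 2 → ℂ)

/-- The point `∞ = [1 : 0]` of the projective line. -/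
def CP1.infty : CP1 := Projectivization.mk ℂ ![1, 0] (by simp)

/-- A flat `G`-bundle over `M`, described by its holonomy: a homomorphism from the fundamental
groupoid of `M` to `G` (the fibre over every point is identified with `G`). The holonomy of a path
that runs first through `γ` and then through `δ` is the product `hol δ * hol γ`. -/
structure FlatBundle (M : Type*) [TopologicalSpace M] (G : Type*) [Group G] where
  hol : ∀ {p q : M}, Path.Homotopic.Quotient p q → G
  hol_trans : ∀ {p q r : M} (γ : Path.Homotopic.Quotient p q) (δ : Path.Homotopic.Quotient q r),
    hol (γ.trans δ) = hol δ * hol γ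

/-- The homotopy class in `M` of a homotopy class of paths in a subspace `B`. -/
def inclPath {M : Type*} [TopologicalSpace M] {B : Set M} {p q : B}
    (γ : Path.Homotopic.Quotient p q) : Path.Homotopic.Quotient (p : M) (q : M) :=
  γ.map (⟨Subtype.val, continuous_subtype_val⟩ : C(B, M))

/-- A triple `(P, s, l)` over a space `M` with boundary `B`: a flat `PSL(2, ℂ)`-bundle `P`, a flat
section `s` over `B` of the associated bundle of projective lines, and a logarithm `l` of the
holonomy of the tautological line bundle over `s` along the loops in `B`, additive for loops with the
same base point and depending only on the free homotopy class of the loop. The bundle `P` is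
trivializable, i.e. it lifts to a flat `SL(2, ℂ)`-bundle, and it is in the rank two vector bundle
of such a lift that the tautological line bundle lives. -/
structure FlatTriple (M : Type*) [TopologicalSpace M] (B : Set M) where
  P : FlatBundle M PSL2C
  s : B → CP1
  s_flat : ∀ {p q : B} (γ : Path.Homotopic.Quotient p q), P.hol (inclPath γ) • s p = s q
  l : ∀ {p : B}, Path.Homotopic.Quotient p p → ℂ
  l_trans : ∀ {p : B} (γ δ : Path.Homotopic.Quotient p p), l (γ.trans δ) = l γ + l δ
  l_conj : ∀ {p q : B} (γ : Path.Homotopic.Quotient p p) (δ : Path.Homotopic.Quotient p q),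
    l ((δ.symm.trans γ).trans δ) = l γ
  exists_lift : ∃ P' : FlatBundle M SL2C,
    (∀ {p q : M} (γ : Path.Homotopic.Quotient p q), (P'.hol γ : PSL2C) = P.hol γ) ∧
    ∀ {p : B} (γ : Path.Homotopic.Quotient p p), ∀ v ∈ (s p).submodule,
      (P'.hol (inclPath γ)).1.mulVec v = Complex.exp (l γ) • v

/-- Equivalence of triples: an isomorphism `g` of flat bundles that matches the sections and the
logarithms. -/
def FlatTriple.Equivalent {M : Type*} [TopologicalSpace M] {B : Set M} (t t' : FlatTriple M B) :
    Prop :=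
  ∃ g : M → PSL2C,
    (∀ {p q : M} (γ : Path.Homotopic.Quotient p q), t'.P.hol γ = g q * t.P.hol γ * (g p)⁻¹) ∧
    (∀ p : B, t'.s p = g p • t.s p) ∧
    ∀ {p : B} (γ : Path.Homotopic.Quotient p p), t'.l γ = t.l γ

theorem FlatTriple.equivalent_refl {M : Type*} [TopologicalSpace M] {B : Set M}
    (t : FlatTriple M B) : t.Equivalent t :=
  ⟨fun _ => 1, fun γ => by simp, fun p => by simp, fun γ => rfl⟩

theorem FlatTriple.Equivalent.symm {M : Type*} [TopologicalSpace M] {B : Set M}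
    {t t' : FlatTriple M B} (h : t.Equivalent t') : t'.Equivalent t := by
  obtain ⟨g, h₁, h₂, h₃⟩ := h
  refine ⟨fun p => (g p)⁻¹, fun γ => ?_, fun p => ?_, fun γ => (h₃ γ).symm⟩
  · rw [h₁ γ]; group
  · rw [h₂ p, inv_smul_smul]

theorem FlatTriple.Equivalent.trans {M : Type*} [TopologicalSpace M] {B : Set M}
    {t t' t'' : FlatTriple M B} (h : t.Equivalent t') (h' : t'.Equivalent t'') :
    t.Equivalent t'' := by
  obtain ⟨g, h₁, h₂, h₃⟩ := h
  obtain ⟨g', h₁', h₂', h₃'⟩ := h'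
  refine ⟨fun p => g' p * g p, fun γ => ?_, fun p => ?_, fun γ => (h₃' γ).trans (h₃ γ)⟩
  · rw [h₁' γ, h₁ γ]; group
  · rw [h₂' p, h₂ p, mul_smul]

instance FlatTriple.setoid (M : Type*) [TopologicalSpace M] (B : Set M) :
    Setoid (FlatTriple M B) where
  r := FlatTriple.Equivalent
  iseqv := ⟨FlatTriple.equivalent_refl, FlatTriple.Equivalent.symm, FlatTriple.Equivalent.trans⟩

/-- The set `R(M)` of equivalence classes of triples, for a space `M` with boundary `B`. -/
def RSet (M : Type*) [TopologicalSpace M] (B : Set M) : Type _ :=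
  Quotient (FlatTriple.setoid M B)

/-- An arc `γ` with ends in the boundary is regular relatively to `(P, s, l)` if the holonomy along
`γ` sends the value of `s` at the source to a point distinct from the value of `s` at the target. -/
def FlatTriple.Regular {M : Type*} [TopologicalSpace M] {B : Set M} (t : FlatTriple M B) {p q : B}
    (γ : Path (p : M) (q : M)) : Prop :=
  t.P.hol (Path.Homotopic.Quotient.mk γ) • t.s p ≠ t.s q

theorem FlatTriple.Equivalent.regular_iff {M : Type*} [TopologicalSpace M] {B : Set M}
    {t t' : FlatTriple M B} (h : t.Equivalent t') {p q : B} (γ : Path (p : M) (q : M)) :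
    t.Regular γ ↔ t'.Regular γ := by
  obtain ⟨g, h₁, h₂, -⟩ := h
  unfold FlatTriple.Regular
  rw [h₁, h₂, h₂, mul_smul, mul_smul, inv_smul_smul, (MulAction.injective (g q)).ne_iff]

/-- Regularity of an arc relatively to an element of `R(M)`. -/
def RSet.Regular {M : Type*} [TopologicalSpace M] {B : Set M} (r : RSet M B) {p q : B}
    (γ : Path (p : M) (q : M)) : Prop :=
  Quotient.lift (fun t : FlatTriple M B => t.Regular γ)
    (fun _ _ h => propext (FlatTriple.Equivalent.regular_iff h γ)) r

/-- `g` is the class of the invertible matrix `A` under `PSL(2, ℂ) = GL(2, ℂ) / ℂ*`. -/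
def IsClassOf (g : PSL2C) (A : Matrix (Fin 2) (Fin 2) ℂ) : Prop :=
  ∃ (S : SL2C) (k : ℂ), k ≠ 0 ∧ (S : PSL2C) = g ∧ S.1 = k • A

/-! ## The 1-skeletons in a triangulated space and the element `φ(X, L)` -/

namespace AbstractTriangulation

variable {I : Type*} {T : AbstractTriangulation I} {M : Type*} [TopologicalSpace M] {B : Set M}

/-- A triangulation of a space `M` with boundary `B` by the abstract triangulation `T`. -/
structure Triangulates (T : AbstractTriangulation I) (M : Type*) [TopologicalSpace M] (B : Set M)
    where
  h : T.Trunc ≃ₜ M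
  image_boundary : h '' T.boundary = B

variable (τ : T.Triangulates M B)

/-- The segment joining two points of a truncated tetrahedron, as a path in `M`. -/
def Triangulates.seg (i : I) (p q : truncTet) : Path (τ.h (T.pt i p)) (τ.h (T.pt i q)) :=
  (segPath p q).map (τ.h.continuous.comp (T.continuous_pt i))

/-- A point of a triangle of a truncated tetrahedron, as a point of the boundary of `M`. -/
def Triangulates.bdryPt (i : I) (p : truncTet) (x : Fin 4) (hp : p.1 x = 2 / 3) : B :=
  ⟨τ.h (T.pt i p), τ.image_boundary.subset (Set.mem_image_of_mem _ ⟨i, p, x, hp, rfl⟩)⟩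

/-- The segment joining two points of a triangle, as a path in the boundary of `M`. -/
def Triangulates.bdrySeg (i : I) (p q : truncTet) (x : Fin 4) (hp : p.1 x = 2 / 3)
    (hq : q.1 x = 2 / 3) : Path (τ.bdryPt i p x hp) (τ.bdryPt i q x hq) where
  toFun t := τ.bdryPt i (segPath p q t) x (segPath_apply_eq hp hq t)
  continuous_toFun := by
    refine Continuous.subtype_mk ?_ _
    exact τ.h.continuous.comp ((T.continuous_pt i).comp (segPath p q).continuous)
  source' := by ext1; simp [bdryPt]
  target' := by ext1; simp [bdryPt]

/-- The edge `(xy, yx)` of `tru(T)`, as an arc in `M` with ends in the boundary. -/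
def Triangulates.interiorEdge (i : I) (x y : Fin 4) (hxy : x ≠ y) :
    Path (τ.bdryPt i (truncVertex x y hxy) x (by simp [truncVertex]) : M)
      (τ.bdryPt i (truncVertex y x hxy.symm) y (by simp [truncVertex]) : M) :=
  τ.seg i (truncVertex x y hxy) (truncVertex y x hxy.symm)

/-- The vertex `xyzt` of `P(T)`, as a point of the boundary of `M`. -/
def Triangulates.vert (o : OrderedTet I) : B :=
  τ.bdryPt o.1 (polyVertex o.2) (o.2 0) (polyVertex_apply_zero o.2)

/-- The edge `(xyzt, yxzt)` of `P(T)`. -/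
def Triangulates.edge₁ (o : OrderedTet I) : Path (τ.vert o : M) (τ.vert o.swap₁ : M) :=
  τ.seg o.1 (polyVertex o.2) (polyVertex (o.2 * swap 0 1))

theorem swap₂_zero (o : OrderedTet I) : o.swap₂.2 0 = o.2 0 := by
  simp [OrderedTet.swap₂, Equiv.swap_apply_of_ne_of_ne]

theorem swap₃_zero (o : OrderedTet I) : o.swap₃.2 0 = o.2 0 := by
  simp [OrderedTet.swap₃, Equiv.swap_apply_of_ne_of_ne]

/-- The edge `(xyzt, xzyt)` of `P(T)`, which lies in the boundary. -/
def Triangulates.edge₂ (o : OrderedTet I) : Path (τ.vert o) (τ.vert o.swap₂) :=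
  τ.bdrySeg o.1 (polyVertex o.2) (polyVertex (o.2 * swap 1 2)) (o.2 0) (polyVertex_apply_zero o.2)
    (swap₂_zero o ▸ polyVertex_apply_zero o.swap₂.2)

/-- The edge `(xyzt, xytz)` of `P(T)`, which lies in the boundary. -/
def Triangulates.edge₃ (o : OrderedTet I) : Path (τ.vert o) (τ.vert o.swap₃) :=
  τ.bdrySeg o.1 (polyVertex o.2) (polyVertex (o.2 * swap 2 3)) (o.2 0) (polyVertex_apply_zero o.2)
    (swap₃_zero o ▸ polyVertex_apply_zero o.swap₃.2)

/-- The logarithm of the upper left entry of the holonomy along the edge `(xyzt, xzyt)`: the holonomy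
is `!![-i, i; 0, i]` if `y < z`, and its inverse otherwise. -/
def Branching.log₂ (b : T.Branching) (o : OrderedTet I) : ℂ :=
  if b.rank o.1 (o.2 1) < b.rank o.1 (o.2 2) then -(Complex.I * Real.pi / 2)
  else Complex.I * Real.pi / 2

/-- `BdryWalk τ b F γ z`: the class `γ` is that of a simplicial path in the boundary of `P(T)`, and
`z` is the sum of the logarithms of the edges along this path, where the edge `(xyzt, xytz)`, whose
holonomy is the diagonal matrix with entries `exp (-L(xyzt)/2)` and `exp (L(xyzt)/2)`, has the
logarithm `-L(xyzt)/2`. -/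
inductive BdryWalk (τ : T.Triangulates M B) {b : T.Branching} {X : T.CrossRatioStructure}
    (F : T.Flattening b X) : {p q : B} → Path.Homotopic.Quotient p q → ℂ → Prop
  | refl (p : B) : BdryWalk τ F (Path.Homotopic.Quotient.refl p) 0
  | step₂ {p : B} (o : OrderedTet I) {γ : Path.Homotopic.Quotient p (τ.vert o)} {z : ℂ} :
      BdryWalk τ F γ z →
      BdryWalk τ F (γ.trans (Path.Homotopic.Quotient.mk (τ.edge₂ o))) (z + b.log₂ o)
  | step₃ {p : B} (o : OrderedTet I) {γ : Path.Homotopic.Quotient p (τ.vert o)} {z : ℂ} :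
      BdryWalk τ F γ z →
      BdryWalk τ F (γ.trans (Path.Homotopic.Quotient.mk (τ.edge₃ o))) (z - F.L o / 2)

/-- The triple `t` is the pair `(c, L)` given by a cross-ratio structure and a flattening: at the
vertices of `P(T)` the section is `∞`, along the edges of `P(T)` the holonomy is the cocycle `c` of
the cross-ratio structure, and along closed simplicial paths in the boundary of `P(T)` the logarithm
is given by the flattening. As the edges of `P(T)` generate the fundamental groupoid, this determines
`t` up to equivalence. -/
structure IsCocycleOf (τ : T.Triangulates M B) {b : T.Branching} {X : T.CrossRatioStructure}
    (F : T.Flattening b X) (t : FlatTriple M B) : Prop where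
  s_vert : ∀ o, t.s (τ.vert o) = CP1.infty
  hol_edge₁ : ∀ o, IsClassOf (t.P.hol (Path.Homotopic.Quotient.mk (τ.edge₁ o))) !![0, 1; 1, 0]
  hol_edge₂ : ∀ o, IsClassOf (t.P.hol (inclPath (Path.Homotopic.Quotient.mk (τ.edge₂ o))))
    !![1, -1; 0, -1]
  hol_edge₃ : ∀ o, IsClassOf (t.P.hol (inclPath (Path.Homotopic.Quotient.mk (τ.edge₃ o))))
    !![1, 0; 0, X.X o]
  l_walk : ∀ {p : B} (γ : Path.Homotopic.Quotient p p) (z : ℂ), BdryWalk τ F γ z → t.l γ = z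

/-- `r = φ(X, L)`. -/
def IsPhi (τ : T.Triangulates M B) {b : T.Branching} (X : T.CrossRatioStructure)
    (F : T.Flattening b X) (r : RSet M B) : Prop :=
  ∃ t : FlatTriple M B, IsCocycleOf τ F t ∧ (Quotient.mk _ t : RSet M B) = r

end AbstractTriangulation

end

/-! Choose a lift of the bundle to `SL(2, ℂ)` and, over every boundary point, a nonzero vector in
the line given by the section. The logarithm `l` extends from loops to paths of the boundary so that
its exponential describes the transport of these vectors (`exists_logSection`). For an edge `xy` let
`[xy]` be the determinant of the vectors at its two ends, transported to a common point; regularity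
says that it is nonzero. It changes sign with the direction of the edge, and the branching provides
a sign that makes it symmetric, so that a logarithm `m(xy)` of the unoriented edge can be chosen.

On each face, look for a function `k` of the orderings with `k(xyz) + k(yxz) = m(xy)` and `k(xzy) -
k(xyz) = w(x;yz)`, where `w` is the logarithm prescribed by the flattening convention minus the
logarithm of the turn around `x` from `xy` to `xz`. The unique solution is `cornerLog`, and the
flattening is `L(xyzt) = 2 (k(xyz) - k(xyt))`. The antisymmetries are formal, the sum around an edge
telescopes because `k` depends on the face only, and the relation with sum `iπ` holds because turns
around a vertex add up (`flattening_rot`).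

The signs of the branching cancel in `exp (2k(xyz)) = -i [xy][xz]/[yz]` (`exp_two_mul_faceLog`).
Hence `exp L` is the cross-ratio `[xz][yt]/([yz][xt])` of the four lines, and the relation for
exchanging `y` and `z` is Plücker's identity (`exp_faceLog_sub_swap₂`).

Finally, trivialize the bundle at the vertex `xyzt` by a frame in which the lines of `x`, `y`, `z`
are `∞`, `0`, `1`. The holonomies along the edges of `P(T)` are then forced by their effect on these
lines (`isCocycleOf_gauge`). On boundary paths the prescribed logarithm differs from the extended
`l` by the coboundary of a function of the vertices, so both agree on loops (`l_eq_of_bdryWalk`). -/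

noncomputable section

/-! ## Combinatorics of ordered tetrahedra -/

namespace OrderedTet

variable {I : Type*} (o : OrderedTet I)

@[simp] theorem swap₁_swap₁ : o.swap₁.swap₁ = o := by
  simp [swap₁, mul_assoc]

@[simp] theorem swap₂_swap₂ : o.swap₂.swap₂ = o := by
  simp [swap₂, mul_assoc]

@[simp] theorem swap₃_swap₃ : o.swap₃.swap₃ = o := by
  simp [swap₃, mul_assoc]

theorem swap₃_swap₁ : o.swap₃.swap₁ = o.swap₁.swap₃ := by
  simp only [swap₁, swap₃, mul_assoc]
  rw [show (swap 2 3 * swap 0 1 : Perm (Fin 4)) = swap 0 1 * swap 2 3 by decide]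

theorem swap₁_swap₂_swap₁ : o.swap₁.swap₂.swap₁ = o.swap₂.swap₁.swap₂ := by
  simp only [swap₁, swap₂, mul_assoc]
  rw [show (swap 0 1 * (swap 1 2 * swap 0 1) : Perm (Fin 4)) =
    swap 1 2 * (swap 0 1 * swap 1 2) by decide]

theorem swap₂_swap₃_swap₂ : o.swap₂.swap₃.swap₂ = o.swap₃.swap₂.swap₃ := by
  simp only [swap₂, swap₃, mul_assoc]
  rw [show (swap 1 2 * (swap 2 3 * swap 1 2) : Perm (Fin 4)) =
    swap 2 3 * (swap 1 2 * swap 2 3) by decide]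

theorem rot_eq : o.rot = o.swap₂.swap₃ := by
  simp only [rot, swap₂, swap₃, mul_assoc]

theorem opp_eq : o.opp = o.swap₂.swap₁.swap₃.swap₂ := by
  simp only [opp, swap₁, swap₂, swap₃, mul_assoc]
  rw [show (swap 0 2 * swap 1 3 : Perm (Fin 4)) =
    swap 1 2 * (swap 0 1 * (swap 2 3 * swap 1 2)) by decide]

@[simp] theorem swap₁_fst : o.swap₁.1 = o.1 := rfl
@[simp] theorem swap₂_fst : o.swap₂.1 = o.1 := rfl
@[simp] theorem swap₃_fst : o.swap₃.1 = o.1 := rfl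

@[simp] theorem swap₁_zero : o.swap₁.2 0 = o.2 1 := by simp [swap₁]
@[simp] theorem swap₁_one : o.swap₁.2 1 = o.2 0 := by simp [swap₁]
@[simp] theorem swap₁_two : o.swap₁.2 2 = o.2 2 := by
  simp [swap₁, swap_apply_of_ne_of_ne]
@[simp] theorem swap₁_three : o.swap₁.2 3 = o.2 3 := by
  simp [swap₁, swap_apply_of_ne_of_ne]
@[simp] theorem swap₂_zero : o.swap₂.2 0 = o.2 0 := by
  simp [swap₂, swap_apply_of_ne_of_ne]
@[simp] theorem swap₂_one : o.swap₂.2 1 = o.2 2 := by simp [swap₂]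
@[simp] theorem swap₂_two : o.swap₂.2 2 = o.2 1 := by simp [swap₂]
@[simp] theorem swap₂_three : o.swap₂.2 3 = o.2 3 := by
  simp [swap₂, swap_apply_of_ne_of_ne]
@[simp] theorem swap₃_zero : o.swap₃.2 0 = o.2 0 := by
  simp [swap₃, swap_apply_of_ne_of_ne]
@[simp] theorem swap₃_one : o.swap₃.2 1 = o.2 1 := by
  simp [swap₃, swap_apply_of_ne_of_ne]
@[simp] theorem swap₃_two : o.swap₃.2 2 = o.2 3 := by simp [swap₃]
@[simp] theorem swap₃_three : o.swap₃.2 3 = o.2 2 := by simp [swap₃]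

theorem ne₀₁ : o.2 0 ≠ o.2 1 := o.2.injective.ne (by decide)
theorem ne₁₂ : o.2 1 ≠ o.2 2 := o.2.injective.ne (by decide)
theorem ne₀₃ : o.2 0 ≠ o.2 3 := o.2.injective.ne (by decide)
theorem ne₁₃ : o.2 1 ≠ o.2 3 := o.2.injective.ne (by decide)

/-- The value `½(m xy + m xz - m yz - w(x;yz) + w(y;xz) + w(z;xy))` at the corner `x` of the face
`xyz`. -/
def cornerLog (m w : OrderedTet I → ℂ) (o : OrderedTet I) : ℂ :=
  (m o + m o.swap₂ - m o.swap₁.swap₂ - w o + w o.swap₁ + w o.swap₂.swap₁) / 2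

/-- This equation and the next one, for all orderings of a face, form a cycle of six equations in
six unknowns. Following the cycle once sends `k` to a constant minus `k`, so the solution exists and
is unique, which explains the factor `½` in `cornerLog`. -/
theorem cornerLog_add_swap₁ {m w : OrderedTet I → ℂ} (hm : ∀ o : OrderedTet I, m o.swap₁ = m o)
    (hw : ∀ o : OrderedTet I, w o.swap₂ = -w o) :
    cornerLog m w o + cornerLog m w o.swap₁ = m o := by
  unfold cornerLog
  simp only [swap₁_swap₁, swap₁_swap₂_swap₁, hm, hw]
  ring

theorem cornerLog_swap₂_sub {m w : OrderedTet I → ℂ} (hm : ∀ o : OrderedTet I, m o.swap₁ = m o)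
    (hw : ∀ o : OrderedTet I, w o.swap₂ = -w o) :
    cornerLog m w o.swap₂ - cornerLog m w o = w o := by
  unfold cornerLog
  simp only [swap₂_swap₂, ← swap₁_swap₂_swap₁, hm, hw]
  ring

end OrderedTet

/-! ### Crossing a face, and signs from the branching -/

namespace AbstractTriangulation

open OrderedTet

variable {I : Type*} (T : AbstractTriangulation I)

/-- The ordered tetrahedron `xyzu` glued to `xyzt` along the face `xyz`. -/
def cross (o : OrderedTet I) : OrderedTet I := (T.nbr o.1 (o.2 3), T.glue o.1 (o.2 3) * o.2)

/-- Turning around an edge splits into a change of face inside a tetrahedron and a crossing of that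
face. Functions invariant under `cross` only see the first move, which is what makes sums around an
edge telescope. -/
theorem next_eq (o : OrderedTet I) : T.next o = T.cross o.swap₃ := by
  unfold next cross
  rw [swap₃_three]
  simp [OrderedTet.swap₃, mul_assoc]

theorem cross_swap₁ (o : OrderedTet I) : T.cross o.swap₁ = (T.cross o).swap₁ := by
  unfold cross
  rw [swap₁_three]
  simp [OrderedTet.swap₁, mul_assoc]

theorem cross_swap₂ (o : OrderedTet I) : T.cross o.swap₂ = (T.cross o).swap₂ := by
  unfold cross
  rw [swap₂_three]
  simp [OrderedTet.swap₂, mul_assoc]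

theorem cornerLog_cross {m w : OrderedTet I → ℂ} (hm : ∀ o, m (T.cross o) = m o)
    (hw : ∀ o, w (T.cross o) = w o) (o : OrderedTet I) :
    cornerLog m w (T.cross o) = cornerLog m w o := by
  unfold cornerLog
  simp only [← cross_swap₁, ← cross_swap₂, hm, hw]

variable {T}

theorem Branching.rank_cross (b : T.Branching) (o : OrderedTet I) {j k : Fin 4} (hj : j ≠ 3)
    (hk : k ≠ 3) : b.rank (T.cross o).1 ((T.cross o).2 j) < b.rank (T.cross o).1 ((T.cross o).2 k) ↔
      b.rank o.1 (o.2 j) < b.rank o.1 (o.2 k) :=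
  (b.compat o.1 (o.2 3) (o.2 j) (o.2 k) (o.2.injective.ne hj) (o.2.injective.ne hk)).symm

theorem Branching.log₂_cross (b : T.Branching) (o : OrderedTet I) :
    b.log₂ (T.cross o) = b.log₂ o := by
  unfold Branching.log₂
  simp only [b.rank_cross o (j := 1) (k := 2) (by decide) (by decide)]

theorem Branching.rank_lt_iff (b : T.Branching) (i : I) {x y : Fin 4} (h : x ≠ y) :
    b.rank i x < b.rank i y ↔ ¬ b.rank i y < b.rank i x := by
  have := (b.rank i).injective.ne h
  omega

theorem Branching.log₂_swap₂ (b : T.Branching) (o : OrderedTet I) :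
    b.log₂ o.swap₂ = -b.log₂ o := by
  unfold Branching.log₂
  have := b.rank_lt_iff o.1 o.ne₁₂
  simp only [swap₂_fst, swap₂_one, swap₂_two]
  by_cases h : b.rank o.1 (o.2 1) < b.rank o.1 (o.2 2)
  · simp [h, this.1 h]
  · rw [this, not_not] at h
    simp [h, (not_congr this).2 (not_not.2 h)]

/-- A sign, `1` on the edges oriented by the branching and `-1` on the others. -/
def Branching.sgn (b : T.Branching) (o : OrderedTet I) : ℂ :=
  if b.rank o.1 (o.2 0) < b.rank o.1 (o.2 1) then 1 else -1

theorem Branching.sgn_cross (b : T.Branching) (o : OrderedTet I) :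
    b.sgn (T.cross o) = b.sgn o := by
  unfold Branching.sgn
  simp only [b.rank_cross o (j := 0) (k := 1) (by decide) (by decide)]

theorem Branching.sgn_swap₃ (b : T.Branching) (o : OrderedTet I) :
    b.sgn o.swap₃ = b.sgn o := by
  simp [Branching.sgn]

theorem Branching.sgn_swap₁ (b : T.Branching) (o : OrderedTet I) :
    b.sgn o.swap₁ = -b.sgn o := by
  unfold Branching.sgn
  have := b.rank_lt_iff o.1 o.ne₀₁
  simp only [swap₁_fst, swap₁_one, swap₁_zero]
  by_cases h : b.rank o.1 (o.2 0) < b.rank o.1 (o.2 1)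
  · simp [h, this.1 h]
  · rw [this, not_not] at h
    simp [h, (not_congr this).2 (not_not.2 h)]

theorem Branching.sgn_mul_self (b : T.Branching) (o : OrderedTet I) :
    b.sgn o * b.sgn o = 1 := by
  unfold Branching.sgn
  split_ifs <;> norm_num

/-! ### From corner logarithms to a flattening -/

section Flattening

variable {b : T.Branching} {m d : OrderedTet I → ℂ}

/-- The six terms pair up into three differences at the vertex `x`, so the sum is `-2` times
`w(x;yz) + w(x;zt) - w(x;yt)`. The turns `d` cancel by additivity, and for `y < z < t` each of the
three `log₂` is `-iπ/2`. -/
theorem flattening_rot (hd : ∀ o : OrderedTet I, d o.swap₂ = -d o)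
    (hd' : ∀ o : OrderedTet I, d o + d o.rot = d o.swap₃)
    (hm : ∀ o : OrderedTet I, m o.swap₁ = m o) (o : OrderedTet I)
    (h₁ : b.rank o.1 (o.2 1) < b.rank o.1 (o.2 2)) (h₂ : b.rank o.1 (o.2 2) < b.rank o.1 (o.2 3)) :
    let k := cornerLog m fun o => b.log₂ o - d o
    2 * (k o - k o.swap₃) + 2 * (k o.rot - k o.rot.swap₃) + 2 * (k o.rot.rot - k o.rot.rot.swap₃) =
      Complex.I * Real.pi := by
  intro k
  have hw : ∀ o : OrderedTet I, b.log₂ o.swap₂ - d o.swap₂ = -(b.log₂ o - d o) := fun o => by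
    rw [b.log₂_swap₂, hd]; ring
  have hk : ∀ o : OrderedTet I, k o.swap₂ - k o = b.log₂ o - d o := fun o =>
    cornerLog_swap₂_sub o hm hw
  have e₁ := hk o
  have e₂ := hk o.rot
  have e₃ := hk o.swap₃
  have e₄ := hd' o
  have r₁ : o.rot.swap₃ = o.swap₂ := by rw [rot_eq, swap₃_swap₃]
  have r₂ : o.rot.rot.swap₃ = o.rot.swap₂ := by rw [rot_eq o.rot, swap₃_swap₃]
  have r₃ : o.rot.rot = o.swap₃.swap₂ := by
    rw [rot_eq o.rot, rot_eq o, swap₂_swap₃_swap₂, swap₃_swap₃]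
  rw [r₁, r₂, r₃]
  have l₁ : b.log₂ o = -(Complex.I * Real.pi / 2) := if_pos h₁
  have l₂ : b.log₂ o.rot = -(Complex.I * Real.pi / 2) := by
    refine if_pos ?_
    simpa [rot_eq] using h₂
  have l₃ : b.log₂ o.swap₃ = -(Complex.I * Real.pi / 2) := by
    refine if_pos ?_
    simpa using h₁.trans h₂
  rw [l₁] at e₁
  rw [l₂] at e₂
  rw [l₃] at e₃
  linear_combination (-2 : ℂ) * e₁ - 2 * e₂ + 2 * e₃ + 2 * e₄

/-- The logarithms of a flattening, as differences of the values of `cornerLog`, form a flattening of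
their exponentials as soon as the latter satisfy the relation of the cross-ratios under `swap₂`. -/
theorem exists_flattening (hd : ∀ o : OrderedTet I, d o.swap₂ = -d o)
    (hd' : ∀ o : OrderedTet I, d o + d o.rot = d o.swap₃) (hdc : ∀ o, d (T.cross o) = d o)
    (hm : ∀ o : OrderedTet I, m o.swap₁ = m o) (hm₃ : ∀ o : OrderedTet I, m o.swap₃ = m o)
    (hmc : ∀ o, m (T.cross o) = m o) {k : OrderedTet I → ℂ}
    (hk : k = cornerLog m fun o => b.log₂ o - d o)
    (hX : ∀ o : OrderedTet I, Complex.exp (2 * (k o.swap₂ - k o.swap₂.swap₃)) =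
      1 - Complex.exp (2 * (k o - k o.swap₃))) :
    ∃ (X : T.CrossRatioStructure) (F : T.Flattening b X), ∀ o, F.L o = 2 * (k o - k o.swap₃) := by
  have hw : ∀ o : OrderedTet I, b.log₂ o.swap₂ - d o.swap₂ = -(b.log₂ o - d o) := fun o => by
    rw [b.log₂_swap₂, hd]; ring
  have hkc : ∀ o, k (T.cross o) = k o := by
    rw [hk]
    exact T.cornerLog_cross hmc fun o => by rw [b.log₂_cross, hdc]
  have hk₁ : ∀ o : OrderedTet I, k o + k o.swap₁ = m o := fun o => by
    rw [hk]
    exact cornerLog_add_swap₁ (w := fun o => b.log₂ o - d o) o hm hw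
  set L : OrderedTet I → ℂ := fun o => 2 * (k o - k o.swap₃) with hL
  have L₃ : ∀ o, L o = -L o.swap₃ := fun o => by
    simp only [hL, swap₃_swap₃]; ring
  have L₁ : ∀ o, L o = -L o.swap₁ := fun o => by
    have e₁ := hk₁ o
    have e₂ := hk₁ o.swap₃
    rw [swap₃_swap₁, hm₃] at e₂
    simp only [hL]
    linear_combination 2 * e₁ - 2 * e₂
  have Le : ∀ o, ∑ j ∈ Finset.range (T.valence o), L (T.next^[j] o) = 0 := fun o => by
    -- Invariance under `cross` gives `k` the same value at `T.next o` and at `o.swap₃`.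
    have : ∀ j, L (T.next^[j] o) = -(2 * k (T.next^[j + 1] o) - 2 * k (T.next^[j] o)) := fun j => by
      rw [Function.iterate_succ_apply', next_eq, hkc]
      simp only [hL]
      ring
    simp only [this, Finset.sum_neg_distrib]
    rw [Finset.sum_range_sub (fun j => 2 * k (T.next^[j] o))]
    -- The last point of the telescoping sum is `o` again; this includes the default value `0` of
    -- the minimal period.
    simp [valence, Function.iterate_minimalPeriod]
  let E : OrderedTet I → ℂ := fun o => Complex.exp (L o)
  have E₀ : ∀ o, E o ≠ 0 := fun o => Complex.exp_ne_zero _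
  have E₁ : ∀ o, E o.swap₁ = (E o)⁻¹ := fun o => by
    simp only [E]; rw [L₁ o, Complex.exp_neg, inv_inv]
  have E₃ : ∀ o, E o.swap₃ = (E o)⁻¹ := fun o => by
    simp only [E]; rw [L₃ o, Complex.exp_neg, inv_inv]
  have E₂ : ∀ o, E o.swap₂ = 1 - E o := hX
  have E' : ∀ o, E o ≠ 1 := fun o h => E₀ o.swap₂ (by rw [E₂, h, sub_self])
  let X : T.CrossRatioStructure :=
    { X := E
      ne_zero := E₀
      ne_one := E'
      X_opp := fun o => by
        have := E₀ o
        have := sub_ne_zero.2 (E' o).symm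
        rw [opp_eq, E₂, E₃, E₁, E₂]
        simp
      X_swap₁ := fun o => by rw [E₁, inv_inv]
      X_swap₃ := fun o => by rw [E₃, inv_inv]
      X_rot := fun o => by rw [rot_eq, E₃, E₂, one_div]
      X_edge := fun o => by
        simp only [E]
        rw [← Complex.exp_sum, Le, Complex.exp_zero] }
  exact ⟨X,
    { L := L
      L_swap₁ := L₁
      L_swap₃ := L₃
      L_rot := fun o h₁ h₂ => by
        simp only [hL, hk]
        exact flattening_rot hd hd' hm o h₁ h₂
      exp_L := fun o => rfl
      L_edge := Le }, fun o => rfl⟩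

end Flattening

end AbstractTriangulation

/-! ## Holonomies and logarithms along the boundary -/

namespace FlatBundle

variable {M G : Type*} [TopologicalSpace M] [Group G] (P : FlatBundle M G)

@[simp] theorem hol_refl (p : M) : P.hol (Path.Homotopic.Quotient.refl p) = 1 := by
  have h := P.hol_trans (Path.Homotopic.Quotient.refl p) (Path.Homotopic.Quotient.refl p)
  rw [Path.Homotopic.Quotient.refl_trans] at h
  exact mul_eq_left.1 h.symm

theorem hol_symm {p q : M} (γ : Path.Homotopic.Quotient p q) : P.hol γ.symm = (P.hol γ)⁻¹ := by
  refine eq_inv_of_mul_eq_one_left ?_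
  rw [← P.hol_trans, Path.Homotopic.Quotient.trans_symm, hol_refl]

/-- The same path of `M` is described in two glued tetrahedra, and then its ends agree only
propositionally. -/
theorem hol_congr {p q p' q' : M} {γ : Path p q} {γ' : Path p' q'} (h : ∀ t, γ t = γ' t) :
    P.hol (Path.Homotopic.Quotient.mk γ) = P.hol (Path.Homotopic.Quotient.mk γ') := by
  obtain rfl : p = p' := by simpa using h 0
  obtain rfl : q = q' := by simpa using h 1
  congr 2
  ext t
  exact h t

end FlatBundle

section InclPath

variable {M : Type*} [TopologicalSpace M] {B : Set M}

theorem inclPath_trans {p q r : B} (γ : Path.Homotopic.Quotient p q) (δ : Path.Homotopic.Quotient q r) :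
    inclPath (γ.trans δ) = (inclPath γ).trans (inclPath δ) := by
  obtain ⟨γ, rfl⟩ := Path.Homotopic.Quotient.mk_surjective γ
 
  obtain ⟨δ, rfl⟩ := Path.Homotopic.Quotient.mk_surjective δ
 
  change Path.Homotopic.Quotient.mk _ = Path.Homotopic.Quotient.mk _
  congr 1
  exact Path.map_trans γ δ continuous_subtype_val

theorem inclPath_symm {p q : B} (γ : Path.Homotopic.Quotient p q) :
    inclPath γ.symm = (inclPath γ).symm := by
  obtain ⟨γ, rfl⟩ := Path.Homotopic.Quotient.mk_surjective γ
  rfl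

end InclPath

theorem CP1.smul_mk (S : SL2C) (v : Fin 2 → ℂ) (hv : v ≠ 0) (hSv : S.1.mulVec v ≠ 0) :
    (S : PSL2C) • Projectivization.mk ℂ v hv = Projectivization.mk ℂ (S.1.mulVec v) hSv := rfl

theorem SL2C.mulVec_ne_zero (S : SL2C) {v : Fin 2 → ℂ} (hv : v ≠ 0) : S.1.mulVec v ≠ 0 := by
  intro h
  apply hv
  have : (S⁻¹ * S).1.mulVec v = 0 := by
    rw [Matrix.SpecialLinearGroup.coe_mul, ← Matrix.mulVec_mulVec, h, Matrix.mulVec_zero]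
  simpa using this

namespace FlatTriple

variable {M : Type*} [TopologicalSpace M] {B : Set M} (t : FlatTriple M B)

theorem l_refl (p : B) : t.l (Path.Homotopic.Quotient.refl p) = 0 := by
  have h := t.l_trans (Path.Homotopic.Quotient.refl p) (Path.Homotopic.Quotient.refl p)
  rw [Path.Homotopic.Quotient.refl_trans] at h
  simpa using h

/-- A lift of a triple to `SL(2, ℂ)`, with a nonzero vector `u p` in the line over every point of the
boundary and an extension of the logarithm to the paths of the boundary, which describes the parallel
transport of the vectors `u p`. -/
structure LogSection where
  P' : FlatBundle M SL2C
  lift : ∀ {p q : M} (γ : Path.Homotopic.Quotient p q), (P'.hol γ : PSL2C) = t.P.hol γ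
  u : B → Fin 2 → ℂ
  u_ne_zero : ∀ p, u p ≠ 0
  mk_u : ∀ p, Projectivization.mk ℂ (u p) (u_ne_zero p) = t.s p
  lam : ∀ {p q : B}, Path.Homotopic.Quotient p q → ℂ
  lam_trans : ∀ {p q r : B} (γ : Path.Homotopic.Quotient p q) (δ : Path.Homotopic.Quotient q r), lam (γ.trans δ) = lam γ + lam δ
  lam_loop : ∀ {p : B} (γ : Path.Homotopic.Quotient p p), lam γ = t.l γ
  hol_u : ∀ {p q : B} (γ : Path.Homotopic.Quotient p q),
    (P'.hol (inclPath γ)).1.mulVec (u p) = Complex.exp (lam γ) • u q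

/-- The class of some path between joined points. -/
def joinClass {a p : B} (h : Joined a p) : Path.Homotopic.Quotient a p := Path.Homotopic.Quotient.mk h.somePath

/-- The logarithm of a path, completed to a loop with the chosen paths from a base point `a`. -/
def lamAt (a : B) {p q : B} (hp : Joined a p) (hq : Joined a q) (γ : Path.Homotopic.Quotient p q) : ℂ :=
  t.l (((joinClass hp).trans γ).trans (joinClass hq).symm)

/-- The chosen base points of two joined points are equal only propositionally; keeping the base
point as a variable allows passing from one to the other. -/
theorem lamAt_congr {a a' : B} (h : a = a') {p q : B} (hp : Joined a p) (hq : Joined a q)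
    (hp' : Joined a' p) (hq' : Joined a' q) (γ : Path.Homotopic.Quotient p q) :
    t.lamAt a hp hq γ = t.lamAt a' hp' hq' γ := by
  subst h
  rfl

theorem lamAt_trans {a p q r : B} (hp : Joined a p) (hq : Joined a q) (hr : Joined a r)
    (γ : Path.Homotopic.Quotient p q) (δ : Path.Homotopic.Quotient q r) :
    t.lamAt a hp hr (γ.trans δ) = t.lamAt a hp hq γ + t.lamAt a hq hr δ := by
  unfold lamAt
  rw [← t.l_trans]
  congr 1
  simp only [Path.Homotopic.Quotient.trans_assoc]
  congr 2
  rw [← Path.Homotopic.Quotient.trans_assoc _ (joinClass hq), Path.Homotopic.Quotient.symm_trans, Path.Homotopic.Quotient.refl_trans]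

theorem lamAt_loop {a p : B} (hp : Joined a p) (γ : Path.Homotopic.Quotient p p) :
    t.lamAt a hp hp γ = t.l γ := by
  have h := t.l_conj γ (joinClass hp).symm
  have h' : (joinClass hp).symm.symm = joinClass hp := by
    unfold joinClass
    rw [← Path.Homotopic.Quotient.mk_symm, ← Path.Homotopic.Quotient.mk_symm, Path.symm_symm]
  rwa [h'] at h

/-- The chosen base point of the path component of a point. -/
def basePt (p : B) : B := (Quotient.mk (pathSetoid B) p).out

theorem joined_basePt (p : B) : Joined (basePt p) p := Quotient.mk_out (s := pathSetoid B) p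

theorem basePt_eq {p q : B} (h : Joined p q) : basePt p = basePt q :=
  congrArg Quotient.out (Quotient.sound (s := pathSetoid B) h)

/-- In each path component of the boundary, a vector over the base point is transported along the
chosen paths to give `u`. Closing a path with these chosen paths turns it into a loop, and the value
of `l` there serves as `lam`; conjugation invariance of `l` makes this agree with `l` on loops. -/
theorem exists_logSection : Nonempty t.LogSection := by
  obtain ⟨P', lift, hl⟩ := t.exists_lift
  let u : B → Fin 2 → ℂ := fun p =>
    (P'.hol (inclPath (joinClass (joined_basePt p)))).1.mulVec (t.s (basePt p)).rep
  have hu : ∀ p, u p ≠ 0 := fun p => SL2C.mulVec_ne_zero _ (Projectivization.rep_nonzero _)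
  have joined_of : ∀ {p q : B}, Path.Homotopic.Quotient p q → Joined p q := fun γ =>
    Path.Homotopic.Quotient.ind (motive := fun _ => Joined _ _) (fun γ => ⟨γ⟩) γ
  have joined_to : ∀ {p q : B}, Path.Homotopic.Quotient p q → Joined (basePt p) q := fun γ =>
    (joined_basePt _).trans (joined_of γ)
  refine ⟨{
    P' := P'
    lift := lift
    u := u
    u_ne_zero := hu
    mk_u := fun p => ?_
    lam := fun {p q} γ => t.lamAt (basePt p) (joined_basePt p) (joined_to γ) γ
    lam_trans := fun {p q r} γ δ => ?_
    lam_loop := fun γ => t.lamAt_loop _ γ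
    hol_u := fun {p q} γ => ?_ }⟩
  · rw [← t.s_flat (joinClass (joined_basePt p)), ← lift]
    conv_rhs => rw [← Projectivization.mk_rep (t.s (basePt p))]
    rw [CP1.smul_mk _ _ _ (hu p)]
  · rw [t.lamAt_trans (joined_basePt p) (joined_to γ)]
    congr 1
    exact t.lamAt_congr (basePt_eq (joined_of γ)) _ _ _ _ δ
  -- The common base point of `p` and `q` becomes a variable, so that both vectors come from the
  -- same vector over it.
  · obtain ⟨a, ha⟩ : ∃ a, a = basePt p := ⟨_, rfl⟩
    have ha' : basePt q = a := by rw [ha, basePt_eq (joined_of γ)]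
    have hp : Joined a p := ha ▸ joined_basePt p
    have hq : Joined a q := ha' ▸ joined_basePt q
    have hup : u p = (P'.hol (inclPath (joinClass hp))).1.mulVec (t.s a).rep := by
      subst ha; rfl
    have huq : u q = (P'.hol (inclPath (joinClass hq))).1.mulVec (t.s a).rep := by
      clear hup hp ha
      subst ha'; rfl
    have h := hl (((joinClass hp).trans γ).trans (joinClass hq).symm) (t.s a).rep
      (by rw [Projectivization.submodule_eq]; exact Submodule.mem_span_singleton_self _)
    rw [inclPath_trans, inclPath_trans, P'.hol_trans, P'.hol_trans, inclPath_symm, P'.hol_symm] at h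
    rw [t.lamAt_congr ha.symm _ _ hp hq, hup, huq, ← Matrix.mulVec_smul]
    unfold lamAt
    rw [← h, Matrix.mulVec_mulVec, Matrix.mulVec_mulVec, ← Matrix.SpecialLinearGroup.coe_mul,
      ← Matrix.SpecialLinearGroup.coe_mul, mul_inv_cancel_left]

namespace LogSection

variable {t} (S : t.LogSection)

@[simp] theorem lam_refl (p : B) : S.lam (Path.Homotopic.Quotient.refl p) = 0 := by
  rw [S.lam_loop, l_refl]

theorem lam_congr {p q p' q' : B} {γ : Path p q} {γ' : Path p' q'} (h : ∀ t, γ t = γ' t) :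
    S.lam (Path.Homotopic.Quotient.mk γ) = S.lam (Path.Homotopic.Quotient.mk γ') := by
  obtain rfl : p = p' := by simpa using h 0
  obtain rfl : q = q' := by simpa using h 1
  congr 2
  ext t
  exact congrArg _ (h t)

end LogSection

end FlatTriple

/-! ## Segments in the truncated tetrahedra -/

theorem Path.Homotopic.Quotient.map_trans {X Y : Type*} [TopologicalSpace X] [TopologicalSpace Y]
    (f : C(X, Y)) {p q r : X} (γ : Path.Homotopic.Quotient p q) (δ : Path.Homotopic.Quotient q r) :
    (γ.trans δ).map f = (γ.map f).trans (δ.map f) := by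
  obtain ⟨γ, rfl⟩ := Path.Homotopic.Quotient.mk_surjective γ
  obtain ⟨δ, rfl⟩ := Path.Homotopic.Quotient.mk_surjective δ
  change Path.Homotopic.Quotient.mk _ = Path.Homotopic.Quotient.mk _
  congr 1
  exact Path.map_trans γ δ f.continuous

theorem Path.Homotopic.Quotient.map_eq_trans_of_simplyConnected {X Y : Type*} [TopologicalSpace X]
    [TopologicalSpace Y] [SimplyConnectedSpace X] (f : C(X, Y)) {p q r : X} (γ : Path p q)
    (δ : Path q r) (ε : Path p r) :
    (Path.Homotopic.Quotient.mk ε).map f =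
      ((Path.Homotopic.Quotient.mk γ).map f).trans ((Path.Homotopic.Quotient.mk δ).map f) := by
  rw [← map_trans, ← mk_trans,
    Path.Homotopic.Quotient.eq.2 (SimplyConnectedSpace.paths_homotopic ε (γ.trans δ))]

theorem polyVertex_eq_zero_iff (σ : Perm (Fin 4)) (f : Fin 4) :
    (polyVertex σ).1 f = 0 ↔ f = σ 3 := by
  obtain ⟨k, rfl⟩ := σ.surjective f
  simp only [polyVertex, symm_apply_apply, σ.injective.eq_iff]
  fin_cases k <;> simp

theorem polyVertex_mul (ρ σ : Perm (Fin 4)) (v : Fin 4) :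
    (polyVertex (ρ * σ)).1 (ρ v) = (polyVertex σ).1 v := by
  simp [polyVertex, Perm.mul_def]

theorem polyVertex_injective : Function.Injective polyVertex := by
  intro σ ρ h
  have hinj : Function.Injective (![2 / 3, 2 / 9, 1 / 9, 0] : Fin 4 → ℝ) := by
    intro i j
    fin_cases i <;> fin_cases j <;> norm_num
  have : σ.symm = ρ.symm := by
    ext1 v
    exact hinj (congrFun (congrArg Subtype.val h) v)
  simpa using congrArg Equiv.symm this

theorem simplyConnectedSpace_truncTet : SimplyConnectedSpace truncTet := by
  have : ContractibleSpace truncTet := convex_truncTet.contractibleSpace ⟨_, (polyVertex 1).2⟩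
  infer_instance

/-- The triangle around the vertex `x` of the truncated tetrahedron. -/
def truncTriangle (x : Fin 4) : Set (Fin 4 → ℝ) := {p | p ∈ truncTet ∧ p x = 2 / 3}

theorem convex_truncTriangle (x : Fin 4) : Convex ℝ (truncTriangle x) := by
  intro p hp q hq a b ha hb hab
  refine ⟨convex_truncTet hp.1 hq.1 ha hb hab, ?_⟩
  simp only [Pi.add_apply, Pi.smul_apply, smul_eq_mul, hp.2, hq.2]
  linear_combination (2 / 3 : ℝ) * hab

namespace AbstractTriangulation

open OrderedTet

variable {I : Type*} {T : AbstractTriangulation I} {M : Type*} [TopologicalSpace M] {B : Set M}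
  (τ : T.Triangulates M B)

namespace Triangulates

theorem seg_trans (i : I) (p q r : truncTet) :
    (Path.Homotopic.Quotient.mk (τ.seg i p q)).trans (Path.Homotopic.Quotient.mk (τ.seg i q r)) =
      Path.Homotopic.Quotient.mk (τ.seg i p r) := by
  have := simplyConnectedSpace_truncTet
  exact (Path.Homotopic.Quotient.map_eq_trans_of_simplyConnected
    ⟨_, τ.h.continuous.comp (T.continuous_pt i)⟩ (segPath p q) (segPath q r) (segPath p r)).symm

/-- The homotopy has to stay in the boundary, so convexity is used for the triangle around `x` and
not for the whole truncated tetrahedron. -/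
theorem bdrySeg_trans (i : I) (p q r : truncTet) (x : Fin 4) (hp : p.1 x = 2 / 3)
    (hq : q.1 x = 2 / 3) (hr : r.1 x = 2 / 3) :
    (Path.Homotopic.Quotient.mk (τ.bdrySeg i p q x hp hq)).trans
      (Path.Homotopic.Quotient.mk (τ.bdrySeg i q r x hq hr)) =
      Path.Homotopic.Quotient.mk (τ.bdrySeg i p r x hp hr) := by
  have : ContractibleSpace (truncTriangle x) :=
    (convex_truncTriangle x).contractibleSpace ⟨p.1, p.2, hp⟩
  let f : C(truncTriangle x, B) :=
    ⟨fun a => τ.bdryPt i ⟨a.1, a.2.1⟩ x a.2.2, by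
      refine Continuous.subtype_mk ?_ _
      refine τ.h.continuous.comp ((T.continuous_pt i).comp ?_)
      exact Continuous.subtype_mk continuous_subtype_val _⟩
  let g (a b : truncTet) (ha : a.1 x = 2 / 3) (hb : b.1 x = 2 / 3) :
      Path (⟨a.1, a.2, ha⟩ : truncTriangle x) ⟨b.1, b.2, hb⟩ :=
    { toFun := fun t => ⟨(segPath a b t).1, (segPath a b t).2, segPath_apply_eq ha hb t⟩
      continuous_toFun :=
        Continuous.subtype_mk (continuous_subtype_val.comp (segPath a b).continuous) _
      source' := by ext1; simp
      target' := by ext1; simp }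
  exact (Path.Homotopic.Quotient.map_eq_trans_of_simplyConnected f (g p q hp hq) (g q r hq hr)
    (g p r hp hr)).symm

end Triangulates

variable (T) in
/-- `q` is the point of the tetrahedron `T.cross o` that is identified with the point `p` of the
face `xyz` of the tetrahedron `xyzt = o`. -/
def Crossing (o : OrderedTet I) (p q : truncTet) : Prop :=
  p.1 (o.2 3) = 0 ∧ ∀ v, q.1 (T.glue o.1 (o.2 3) v) = p.1 v

theorem Crossing.pt_eq {o : OrderedTet I} {p q : truncTet} (h : T.Crossing o p q) :
    T.pt o.1 p = T.pt (T.cross o).1 q :=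
  Quot.sound ⟨o.2 3, h.1, rfl, h.2⟩

/-- The gluing of two faces is affine, hence identifies segments with segments. -/
theorem Crossing.segPath {o : OrderedTet I} {p q p' q' : truncTet} (h : T.Crossing o p p')
    (h' : T.Crossing o q q') (t : unitInterval) :
    T.Crossing o (segPath p q t) (segPath p' q' t) := by
  have key : ∀ (a b : truncTet) (v : Fin 4),
      (_root_.segPath a b t).1 v = (1 - (t : ℝ)) * a.1 v + t * b.1 v := fun a b v => by
    change (AffineMap.lineMap a.1 b.1 (t : ℝ) : Fin 4 → ℝ) v = _
    simp [AffineMap.lineMap_apply_module]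
  refine ⟨?_, fun v => ?_⟩
  · rw [key, h.1, h'.1]; ring
  · rw [key, key, h.2, h'.2]

theorem crossing_polyVertex (o : OrderedTet I) :
    T.Crossing o (polyVertex o.2) (polyVertex (T.cross o).2) :=
  ⟨(polyVertex_eq_zero_iff _ _).2 rfl, fun v => polyVertex_mul _ _ v⟩

theorem Glued.symm {a b : Σ _ : I, truncTet} (h : T.Glued a b) : T.Glued b a := by
  obtain ⟨f, hf, hb, hv⟩ := h
  refine ⟨T.glue a.1 f f, by rw [hv, hf], by rw [hb, T.nbr_nbr], fun v => ?_⟩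
  rw [hb, T.glue_glue, ← hv]
  simp

/-- A function of the vertices of the tetrahedra that is compatible with the identifications of the
faces is a function of the points of `M`. -/
theorem Triangulates.exists_point_fun {α : Type*} [Inhabited α] (φ : OrderedTet I → α)
    (hφ : ∀ o, φ (T.cross o) = φ o) : ∃ K : M → α, ∀ o, K (τ.vert o) = φ o := by
  classical
  -- The set of values at the vertices located at a point, empty at the other points. Being
  -- set-valued it is defined everywhere and descends to the quotient; at a vertex it is a singleton
  -- because `polyVertex` is injective.
  let Φ : (Σ _ : I, truncTet) → Set α := fun a => {c | ∃ σ, a.2 = polyVertex σ ∧ φ (a.1, σ) = c}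
  have hsub : ∀ a b, T.Glued a b → Φ a ⊆ Φ b := by
    rintro ⟨i, p⟩ ⟨j, q⟩ ⟨f, hf, hj, hv⟩ c ⟨σ, hp, hc⟩
    dsimp only at hf hj hv hp hc
    subst hj hp
    rw [polyVertex_eq_zero_iff] at hf
    subst hf
    refine ⟨T.glue i (σ 3) * σ, ?_, (hφ (i, σ)).trans hc⟩
    ext v
    obtain ⟨w, rfl⟩ := (T.glue i (σ 3)).surjective v
    rw [hv, polyVertex_mul]
  have hΦ : ∀ a b, T.Glued a b → Φ a = Φ b := fun a b h =>
    (hsub a b h).antisymm (hsub b a h.symm)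
  let Ψ : M → Set α := fun m => Quot.lift Φ hΦ (τ.h.symm m)
  have hΨ : ∀ o : OrderedTet I, Ψ (τ.vert o) = {φ o} := fun o => by
    have : Ψ (τ.vert o) = Φ ⟨o.1, polyVertex o.2⟩ := by
      simp only [Ψ, vert, bdryPt, Homeomorph.symm_apply_apply]
      rfl
    rw [this]
    ext c
    constructor
    · rintro ⟨σ, h, rfl⟩
      rw [← polyVertex_injective h]
      rfl
    · rintro rfl
      exact ⟨o.2, rfl, rfl⟩
  refine ⟨fun m => if h : (Ψ m).Nonempty then h.some else default, fun o => ?_⟩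
  have h : (Ψ (τ.vert o)).Nonempty := hΨ o ▸ Set.singleton_nonempty _
  refine (dif_pos h).trans ?_
  exact (hΨ o).subset h.some_mem

end AbstractTriangulation

namespace OrderedTet

variable {I : Type*} (o : OrderedTet I)

/-- The vertex `xy` of the truncated tetrahedron `xyzt`. -/
def edgeVertex : truncTet := truncVertex (o.2 0) (o.2 1) o.ne₀₁

theorem edgeVertex_apply_zero : o.edgeVertex.1 (o.2 0) = 2 / 3 := by
  simp [edgeVertex, truncVertex]

theorem edgeVertex_swap₂_apply : o.swap₂.edgeVertex.1 (o.2 0) = 2 / 3 := by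
  simpa using o.swap₂.edgeVertex_apply_zero

theorem edgeVertex_swap₃ : o.swap₃.edgeVertex = o.edgeVertex := by
  simp [edgeVertex]

theorem edgeVertex_swap₃_swap₁ : o.swap₃.swap₁.edgeVertex = o.swap₁.edgeVertex := by
  rw [swap₃_swap₁, edgeVertex_swap₃]

end OrderedTet

namespace AbstractTriangulation

variable {I : Type*} {T : AbstractTriangulation I}

theorem crossing_edgeVertex (o : OrderedTet I) :
    T.Crossing o o.edgeVertex (T.cross o).edgeVertex := by
  refine ⟨?_, fun v => ?_⟩
  · simp [OrderedTet.edgeVertex, truncVertex, o.ne₀₃.symm, o.ne₁₃.symm]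
  · simp [OrderedTet.edgeVertex, truncVertex, cross]

end AbstractTriangulation

/-! ## Brackets of the vectors of the section -/

/-- The determinant of two vectors of the plane. -/
def bracket (v w : Fin 2 → ℂ) : ℂ := v 0 * w 1 - v 1 * w 0

theorem bracket_smul_left (c : ℂ) (v w : Fin 2 → ℂ) : bracket (c • v) w = c * bracket v w := by
  simp only [bracket, Pi.smul_apply, smul_eq_mul]; ring

theorem bracket_smul_right (c : ℂ) (v w : Fin 2 → ℂ) : bracket v (c • w) = c * bracket v w := by
  simp only [bracket, Pi.smul_apply, smul_eq_mul]; ring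

theorem bracket_swap (v w : Fin 2 → ℂ) : bracket w v = -bracket v w := by
  simp only [bracket]; ring

theorem bracket_plucker (a b c d : Fin 2 → ℂ) :
    bracket a b * bracket c d - bracket a c * bracket b d + bracket a d * bracket b c = 0 := by
  simp only [bracket]; ring

theorem bracket_mulVec (S : SL2C) (v w : Fin 2 → ℂ) :
    bracket (S.1.mulVec v) (S.1.mulVec w) = bracket v w := by
  have h := S.2
  rw [Matrix.det_fin_two] at h
  simp only [bracket, Matrix.mulVec, dotProduct, Fin.sum_univ_two]
  linear_combination (v 0 * w 1 - v 1 * w 0) * h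

theorem mk_eq_mk_of_bracket_eq_zero {v w : Fin 2 → ℂ} (hv : v ≠ 0) (hw : w ≠ 0)
    (h : bracket v w = 0) : Projectivization.mk ℂ v hv = Projectivization.mk ℂ w hw := by
  rw [Projectivization.mk_eq_mk_iff']
  simp only [bracket] at h
  by_cases h₀ : w 0 = 0
  · have h₁ : w 1 ≠ 0 := fun h₁ => hw (by ext i; fin_cases i <;> simp [h₀, h₁])
    refine ⟨v 1 / w 1, ?_⟩
    ext i
    fin_cases i
    · simp [h₀] at h ⊢
      rcases h with h | h
      · exact h.symm
      · exact absurd h h₁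
    · simp [h₁]
  · refine ⟨v 0 / w 0, ?_⟩
    ext i
    fin_cases i
    · simp [h₀]
    · simp only [Fin.mk_one, Pi.smul_apply, smul_eq_mul]
      field_simp
      linear_combination h

/-! ### Brackets of edges and logarithms of turns -/

namespace FlatTriple.LogSection

open AbstractTriangulation OrderedTet

variable {I : Type*} {T : AbstractTriangulation I} {M : Type*} [TopologicalSpace M] {B : Set M}
  {t : FlatTriple M B} (S : t.LogSection) (τ : T.Triangulates M B)

open Classical in
/-- The vector of the section at a point of `M`, zero outside the boundary. -/
def vec (m : M) : Fin 2 → ℂ := if h : m ∈ B then S.u ⟨m, h⟩ else 0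

theorem vec_coe (p : B) : S.vec p = S.u p := dif_pos p.2

/-- The holonomy along the segment from `p` to `q`. -/
def segHol (i : I) (p q : truncTet) : SL2C := S.P'.hol (Path.Homotopic.Quotient.mk (τ.seg i p q))

/-- The vector of the section at `p`, transported to `q` along a segment. -/
def transp (i : I) (q p : truncTet) : Fin 2 → ℂ :=
  (S.segHol τ i p q).1.mulVec (S.vec (τ.h (T.pt i p)))

/-- The logarithm of a segment of the triangle around `x`. -/
def segLog (i : I) (p q : truncTet) (x : Fin 4) (hp : p.1 x = 2 / 3) (hq : q.1 x = 2 / 3) : ℂ :=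
  S.lam (Path.Homotopic.Quotient.mk (τ.bdrySeg i p q x hp hq))

theorem segHol_mul (i : I) (p q r : truncTet) :
    S.segHol τ i q r * S.segHol τ i p q = S.segHol τ i p r := by
  rw [segHol, segHol, ← S.P'.hol_trans, τ.seg_trans]
  rfl

theorem segHol_self (i : I) (p : truncTet) : S.segHol τ i p p = 1 := by
  have := S.segHol_mul τ i p p p
  exact mul_eq_left.1 this

theorem segHol_mulVec_transp (i : I) (p q r : truncTet) :
    (S.segHol τ i q r).1.mulVec (S.transp τ i q p) = S.transp τ i r p := by
  rw [transp, Matrix.mulVec_mulVec, ← Matrix.SpecialLinearGroup.coe_mul, segHol_mul]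
  rfl

theorem transp_self (i : I) (p : truncTet) (x : Fin 4) (hp : p.1 x = 2 / 3) :
    S.transp τ i p p = S.u (τ.bdryPt i p x hp) := by
  rw [transp, segHol_self, ← vec_coe]
  simp [Triangulates.bdryPt]

/-- Holonomies in `SL(2, ℂ)` preserve determinants and segments of one tetrahedron compose, so all
brackets of a tetrahedron may be computed at any common point. -/
theorem bracket_transp (i : I) (p p' q r : truncTet) :
    bracket (S.transp τ i q p) (S.transp τ i q p') =
      bracket (S.transp τ i r p) (S.transp τ i r p') := by
  rw [← S.segHol_mulVec_transp τ i p q r, ← S.segHol_mulVec_transp τ i p' q r, bracket_mulVec]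

theorem transp_eq_smul (i : I) (p q r : truncTet) (x : Fin 4) (hp : p.1 x = 2 / 3)
    (hq : q.1 x = 2 / 3) :
    S.transp τ i r p = Complex.exp (S.segLog τ i p q x hp hq) • S.transp τ i r q := by
  have h : (S.segHol τ i p q).1.mulVec (S.vec (τ.bdryPt i p x hp)) =
      Complex.exp (S.segLog τ i p q x hp hq) • S.vec (τ.bdryPt i q x hq) := by
    rw [vec_coe, vec_coe]
    exact S.hol_u (Path.Homotopic.Quotient.mk (τ.bdrySeg i p q x hp hq))
  have h' : S.transp τ i r p = (S.segHol τ i q r).1.mulVec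
      ((S.segHol τ i p q).1.mulVec (S.vec (τ.bdryPt i p x hp))) :=
    (S.segHol_mulVec_transp τ i p q r).symm
  rw [h', h, Matrix.mulVec_smul]
  rfl

theorem segLog_trans (i : I) (p q r : truncTet) (x : Fin 4) (hp : p.1 x = 2 / 3)
    (hq : q.1 x = 2 / 3) (hr : r.1 x = 2 / 3) :
    S.segLog τ i p q x hp hq + S.segLog τ i q r x hq hr = S.segLog τ i p r x hp hr := by
  rw [segLog, segLog, ← S.lam_trans, τ.bdrySeg_trans]
  rfl

theorem segLog_self (i : I) (p : truncTet) (x : Fin 4) (hp : p.1 x = 2 / 3) :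
    S.segLog τ i p p x hp hp = 0 := by
  have := S.segLog_trans τ i p p p x hp hp hp
  exact add_eq_left.1 this

theorem segLog_symm (i : I) (p q : truncTet) (x : Fin 4) (hp : p.1 x = 2 / 3)
    (hq : q.1 x = 2 / 3) : S.segLog τ i q p x hq hp = -S.segLog τ i p q x hp hq := by
  have h := S.segLog_trans τ i p q p x hp hq hp
  rw [segLog_self] at h
  exact eq_neg_of_add_eq_zero_right h

theorem seg_cross {o : OrderedTet I} {p q p' q' : truncTet} (hp : T.Crossing o p p')
    (hq : T.Crossing o q q') (s : unitInterval) :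
    τ.seg (T.cross o).1 p' q' s = τ.seg o.1 p q s :=
  congrArg τ.h (hp.segPath hq s).pt_eq.symm

theorem segHol_cross {o : OrderedTet I} {p q p' q' : truncTet} (hp : T.Crossing o p p')
    (hq : T.Crossing o q q') : S.segHol τ (T.cross o).1 p' q' = S.segHol τ o.1 p q :=
  S.P'.hol_congr (seg_cross τ hp hq)

theorem transp_cross {o : OrderedTet I} {p q p' q' : truncTet} (hp : T.Crossing o p p')
    (hq : T.Crossing o q q') : S.transp τ (T.cross o).1 q' p' = S.transp τ o.1 q p := by
  rw [transp, transp, S.segHol_cross τ hp hq, hp.pt_eq]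

theorem segLog_cross {o : OrderedTet I} {p q p' q' : truncTet} (hp : T.Crossing o p p')
    (hq : T.Crossing o q q') (x x' : Fin 4) (h₁ : p.1 x = 2 / 3) (h₂ : q.1 x = 2 / 3)
    (h₁' : p'.1 x' = 2 / 3) (h₂' : q'.1 x' = 2 / 3) :
    S.segLog τ (T.cross o).1 p' q' x' h₁' h₂' = S.segLog τ o.1 p q x h₁ h₂ :=
  S.lam_congr fun s => Subtype.ext (seg_cross τ hp hq s)

/-- The bracket of the values of the section at both ends of the edge `xy`. -/
def edgeBracket (o : OrderedTet I) : ℂ :=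
  bracket (S.transp τ o.1 o.edgeVertex o.edgeVertex)
    (S.transp τ o.1 o.edgeVertex o.swap₁.edgeVertex)

theorem edgeBracket_eq (o : OrderedTet I) (q : truncTet) : S.edgeBracket τ o =
    bracket (S.transp τ o.1 q o.edgeVertex) (S.transp τ o.1 q o.swap₁.edgeVertex) :=
  S.bracket_transp τ _ _ _ _ _

theorem edgeBracket_swap₁ (o : OrderedTet I) :
    S.edgeBracket τ o.swap₁ = -S.edgeBracket τ o := by
  rw [S.edgeBracket_eq τ o o.swap₁.edgeVertex, edgeBracket, swap₁_swap₁, swap₁_fst, bracket_swap]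

theorem edgeBracket_swap₃ (o : OrderedTet I) :
    S.edgeBracket τ o.swap₃ = S.edgeBracket τ o := by
  rw [edgeBracket, edgeVertex_swap₃_swap₁, edgeVertex_swap₃]
  rfl

theorem crossing_edgeVertex_swap₁ (o : OrderedTet I) :
    T.Crossing o o.swap₁.edgeVertex (T.cross o).swap₁.edgeVertex := by
  have h := crossing_edgeVertex (T := T) o.swap₁
  rw [cross_swap₁] at h
  simpa [Crossing] using h

theorem crossing_edgeVertex_swap₂ (o : OrderedTet I) :
    T.Crossing o o.swap₂.edgeVertex (T.cross o).swap₂.edgeVertex := by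
  have h := crossing_edgeVertex (T := T) o.swap₂
  rw [cross_swap₂] at h
  simpa [Crossing] using h

theorem crossing_edgeVertex_swap₂_swap₁ (o : OrderedTet I) :
    T.Crossing o o.swap₂.swap₁.edgeVertex (T.cross o).swap₂.swap₁.edgeVertex := by
  have h := crossing_edgeVertex_swap₁ (T := T) o.swap₂
  rw [cross_swap₂] at h
  simpa [Crossing] using h

theorem edgeBracket_cross (o : OrderedTet I) :
    S.edgeBracket τ (T.cross o) = S.edgeBracket τ o := by
  rw [edgeBracket, S.transp_cross τ (crossing_edgeVertex o) (crossing_edgeVertex o),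
    S.transp_cross τ (crossing_edgeVertex_swap₁ o) (crossing_edgeVertex o)]
  rfl

/-- This is where regularity enters: a vanishing bracket would make the transported line equal to
the line at the other end. -/
theorem edgeBracket_ne_zero
    (hr : ∀ (i : I) (x y : Fin 4) (hxy : x ≠ y), t.Regular (τ.interiorEdge i x y hxy))
    (o : OrderedTet I) : S.edgeBracket τ o ≠ 0 := by
  intro h
  refine hr o.1 (o.2 0) (o.2 1) o.ne₀₁ ?_
  have hv : τ.bdryPt o.1 (truncVertex (o.2 0) (o.2 1) o.ne₀₁) (o.2 0) (by simp [truncVertex]) =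
    τ.bdryPt o.1 o.edgeVertex (o.2 0) o.edgeVertex_apply_zero := rfl
  have h1 : o.swap₁.edgeVertex.1 (o.2 1) = 2 / 3 := by
    simpa using o.swap₁.edgeVertex_apply_zero
  have e : o.swap₁.edgeVertex = truncVertex (o.2 1) (o.2 0) o.ne₀₁.symm := by
    simp [edgeVertex]
  rw [S.edgeBracket_eq τ o o.swap₁.edgeVertex, S.transp_self τ _ _ (o.2 1) h1, transp,
    show τ.h (T.pt o.1 o.edgeVertex) =
      (τ.bdryPt o.1 o.edgeVertex (o.2 0) o.edgeVertex_apply_zero : M) from rfl, vec_coe] at h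
  simp only [e] at h
  rw [← S.mk_u, ← S.mk_u, ← S.lift, CP1.smul_mk _ _ _ (SL2C.mulVec_ne_zero _ (S.u_ne_zero _))]
  exact mk_eq_mk_of_bracket_eq_zero _ _ h

/-- The logarithm of the path around `x` from the edge `xy` to the edge `xz`. -/
def turnLog (o : OrderedTet I) : ℂ :=
  S.segLog τ o.1 o.edgeVertex o.swap₂.edgeVertex (o.2 0) o.edgeVertex_apply_zero
    o.edgeVertex_swap₂_apply

theorem segLog_congr (i : I) {p q p' q' : truncTet} {x x' : Fin 4} (h₁ : p.1 x = 2 / 3)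
    (h₂ : q.1 x = 2 / 3) (h₁' : p'.1 x' = 2 / 3) (h₂' : q'.1 x' = 2 / 3) (hp : p = p')
    (hq : q = q') (hx : x = x') : S.segLog τ i p q x h₁ h₂ = S.segLog τ i p' q' x' h₁' h₂' := by
  subst hp hq hx
  rfl

theorem turnLog_swap₂ (o : OrderedTet I) : S.turnLog τ o.swap₂ = -S.turnLog τ o := by
  rw [turnLog, turnLog, ← segLog_symm]
  exact S.segLog_congr τ _ _ _ _ _ rfl (by rw [swap₂_swap₂]) o.swap₂_zero

/-- The turns from `xy` to `xz` and from `xz` to `xt` take place in the same triangle around `x`,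
where they compose to the turn from `xy` to `xt`. -/
theorem turnLog_rot (o : OrderedTet I) :
    S.turnLog τ o + S.turnLog τ o.rot = S.turnLog τ o.swap₃ := by
  have hx : o.rot.2 0 = o.2 0 := by simp [rot_eq]
  have h₁ : o.rot.edgeVertex = o.swap₂.edgeVertex := by rw [rot_eq, edgeVertex_swap₃]
  have h₂ : o.rot.swap₂.edgeVertex = o.swap₃.swap₂.edgeVertex := by
    rw [rot_eq, swap₂_swap₃_swap₂, edgeVertex_swap₃]
  have h₃ : o.swap₃.swap₂.edgeVertex.1 (o.2 0) = 2 / 3 := by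
    simpa using o.swap₃.edgeVertex_swap₂_apply
  have e₁ : S.turnLog τ o.rot = S.segLog τ o.1 o.swap₂.edgeVertex o.swap₃.swap₂.edgeVertex (o.2 0)
      o.edgeVertex_swap₂_apply h₃ := S.segLog_congr τ _ _ _ _ _ h₁ h₂ hx
  have e₂ : S.turnLog τ o.swap₃ = S.segLog τ o.1 o.edgeVertex o.swap₃.swap₂.edgeVertex (o.2 0)
      o.edgeVertex_apply_zero h₃ := S.segLog_congr τ _ _ _ _ _ o.edgeVertex_swap₃ rfl (by simp)
  rw [e₁, e₂, turnLog, segLog_trans]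

theorem turnLog_cross (o : OrderedTet I) : S.turnLog τ (T.cross o) = S.turnLog τ o :=
  S.segLog_cross τ (crossing_edgeVertex o) (crossing_edgeVertex_swap₂ o) _ _ _ _ _ _

/-- A logarithm of the bracket along the edge `xy`, oriented by the branching. -/
def edgeLog (b : T.Branching) (o : OrderedTet I) : ℂ := Complex.log (b.sgn o * S.edgeBracket τ o)

variable (b : T.Branching)

/-- The bracket and the sign of the branching both change sign when the edge is reversed. -/
theorem edgeLog_swap₁ (o : OrderedTet I) : S.edgeLog τ b o.swap₁ = S.edgeLog τ b o := by
  rw [edgeLog, b.sgn_swap₁, edgeBracket_swap₁, neg_mul_neg]; rfl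

theorem edgeLog_swap₃ (o : OrderedTet I) : S.edgeLog τ b o.swap₃ = S.edgeLog τ b o := by
  rw [edgeLog, b.sgn_swap₃, edgeBracket_swap₃]; rfl

theorem edgeLog_cross (o : OrderedTet I) : S.edgeLog τ b (T.cross o) = S.edgeLog τ b o := by
  rw [edgeLog, b.sgn_cross, edgeBracket_cross]; rfl

/-- The value at the corner `x` of the face `xyz` that the logarithms of a flattening are differences
of. -/
def faceLog : OrderedTet I → ℂ :=
  cornerLog (S.edgeLog τ b) fun o => b.log₂ o - S.turnLog τ o

theorem faceLog_cross (o : OrderedTet I) : S.faceLog τ b (T.cross o) = S.faceLog τ b o :=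
  T.cornerLog_cross (S.edgeLog_cross τ b)
    (fun o => by rw [b.log₂_cross, turnLog_cross]) o

theorem faceLog_swap₂_sub (o : OrderedTet I) :
    S.faceLog τ b o.swap₂ - S.faceLog τ b o = b.log₂ o - S.turnLog τ o :=
  cornerLog_swap₂_sub (w := fun o => b.log₂ o - S.turnLog τ o) o (S.edgeLog_swap₁ τ b)
    fun o => by rw [b.log₂_swap₂, turnLog_swap₂]; ring

/-- The sign is that of the edge `yz`, opposite to the corner `x`; it is there to cancel against the
signs in `edgeLog`. -/
theorem _root_.AbstractTriangulation.Branching.exp_log₂ (o : OrderedTet I) :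
    Complex.exp (b.log₂ o) = -Complex.I * b.sgn o.swap₁.swap₂ := by
  have h : Complex.exp (Complex.I * Real.pi / 2) = Complex.I := by
    rw [show Complex.I * Real.pi / 2 = Real.pi / 2 * Complex.I by ring, Complex.exp_pi_div_two_mul_I]
  simp only [Branching.log₂, Branching.sgn, swap₂_fst, swap₁_fst, OrderedTet.swap₂_zero, swap₂_one,
    swap₁_zero, swap₁_two]
  split_ifs
  · rw [Complex.exp_neg, h, Complex.inv_I, mul_one]
  · rw [h]; ring

/-- Each edge of the face contributes its sign twice, once through `edgeLog` and once through `log₂`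
at the opposite corner. The turns move the vector at each corner from one edge of the face to the
other, so that each line is represented by a single vector. Only the factor `-i` remains. -/
theorem exp_two_mul_faceLog (h₀ : ∀ o, S.edgeBracket τ o ≠ 0) (o : OrderedTet I) (q : truncTet) :
    Complex.exp (2 * S.faceLog τ b o) * bracket (S.transp τ o.1 q o.swap₁.edgeVertex)
      (S.transp τ o.1 q o.swap₂.swap₁.edgeVertex) =
    -Complex.I * (bracket (S.transp τ o.1 q o.edgeVertex) (S.transp τ o.1 q o.swap₁.edgeVertex) *
      bracket (S.transp τ o.1 q o.edgeVertex) (S.transp τ o.1 q o.swap₂.swap₁.edgeVertex)) := by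
  have hm : ∀ o, Complex.exp (S.edgeLog τ b o) = b.sgn o * S.edgeBracket τ o := fun o =>
    Complex.exp_log (mul_ne_zero (left_ne_zero_of_mul_eq_one (b.sgn_mul_self o)) (h₀ o))
  have hturn : ∀ o' : OrderedTet I, o'.1 = o.1 → S.transp τ o.1 q o'.edgeVertex =
      Complex.exp (S.turnLog τ o') • S.transp τ o.1 q o'.swap₂.edgeVertex := by
    intro o' ho
    rw [← ho]
    exact S.transp_eq_smul τ _ _ _ _ _ _ _
  have b₁ := S.edgeBracket_eq τ o q
  have b₂ := S.edgeBracket_eq τ o.swap₂ q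
  have b₃ := S.edgeBracket_eq τ o.swap₁.swap₂ q
  have n₃ := h₀ o.swap₁.swap₂
  have t₁ := hturn o rfl
  have t₂ := hturn o.swap₁ rfl
  have t₃ := hturn o.swap₂.swap₁ rfl
  rw [← swap₁_swap₂_swap₁] at t₃
  simp only [swap₂_fst, swap₁_fst] at b₂ b₃
  have l₁ := b.exp_log₂ o
  have l₂ := b.exp_log₂ o.swap₁
  have l₃ := b.exp_log₂ o.swap₂.swap₁
  rw [swap₁_swap₁] at l₂ l₃
  rw [swap₂_swap₂] at l₃
  have s₁ := b.sgn_mul_self o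
  have s₂ := b.sgn_mul_self o.swap₂
  have s₃ := b.sgn_mul_self o.swap₁.swap₂
  have hE : Complex.exp (2 * S.faceLog τ b o) =
      Complex.exp (S.edgeLog τ b o) * Complex.exp (S.edgeLog τ b o.swap₂) /
        Complex.exp (S.edgeLog τ b o.swap₁.swap₂) *
      (Complex.exp (S.turnLog τ o) / Complex.exp (b.log₂ o)) *
      (Complex.exp (b.log₂ o.swap₁) / Complex.exp (S.turnLog τ o.swap₁)) *
      (Complex.exp (b.log₂ o.swap₂.swap₁) / Complex.exp (S.turnLog τ o.swap₂.swap₁)) := by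
    simp only [← Complex.exp_add, ← Complex.exp_sub]
    congr 1
    unfold faceLog cornerLog
    ring
  have e₁ := Complex.exp_ne_zero (S.turnLog τ o)
  have e₂ := Complex.exp_ne_zero (S.turnLog τ o.swap₁)
  have e₃ := Complex.exp_ne_zero (S.turnLog τ o.swap₂.swap₁)
  rw [hE, hm, hm, hm, l₁, l₂, l₃]
  have c₁ : bracket (S.transp τ o.1 q o.swap₁.edgeVertex)
      (S.transp τ o.1 q o.swap₂.swap₁.edgeVertex) =
      Complex.exp (S.turnLog τ o.swap₁) * Complex.exp (S.turnLog τ o.swap₂.swap₁) *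
        S.edgeBracket τ o.swap₁.swap₂ := by
    rw [t₂, t₃, bracket_smul_left, bracket_smul_right, b₃, mul_assoc]
  have c₂ : bracket (S.transp τ o.1 q o.edgeVertex) (S.transp τ o.1 q o.swap₂.swap₁.edgeVertex) =
      Complex.exp (S.turnLog τ o) * S.edgeBracket τ o.swap₂ := by
    rw [t₁, bracket_smul_left, b₂]
  rw [c₁, c₂, ← b₁]
  have i₃ := left_ne_zero_of_mul_eq_one s₃
  have hI := Complex.I_ne_zero
  field_simp
  linear_combination (-S.edgeBracket τ o * S.edgeBracket τ o.swap₂) *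
    (b.sgn o.swap₂ ^ 2 * s₁ + s₂ - s₃)

end FlatTriple.LogSection

/-! ## Frames adapted to three lines -/

theorem exists_frame {a b c : Fin 2 → ℂ} (hab : bracket a b ≠ 0) (hac : bracket a c ≠ 0)
    (hbc : bracket b c ≠ 0) : ∃ (S : SL2C) (α β γ : ℂ), α ≠ 0 ∧ β ≠ 0 ∧ γ ≠ 0 ∧
      S.1.mulVec a = ![α, 0] ∧ S.1.mulVec b = ![0, β] ∧ S.1.mulVec c = ![γ, γ] := by
  -- The map with coordinates `[ac][vb]` and `[bc][va]` sends the three lines to the required ones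
  -- and has determinant `-[ab][ac][bc]`; dividing by a square root of it gives determinant one.
  obtain ⟨k, hk⟩ := IsAlgClosed.exists_eq_mul_self (-(bracket a b * bracket a c * bracket b c))
  have hk₀ : k ≠ 0 := by
    rintro rfl
    rw [mul_zero, neg_eq_zero] at hk
    exact mul_ne_zero (mul_ne_zero hab hac) hbc hk
  refine ⟨⟨k⁻¹ • !![bracket a c * b 1, -bracket a c * b 0; bracket b c * a 1, -bracket b c * a 0],
    ?_⟩, k⁻¹ * (bracket a c * bracket a b), -(k⁻¹ * (bracket b c * bracket a b)),
    -(k⁻¹ * (bracket a c * bracket b c)), ?_, ?_, ?_, ?_, ?_, ?_⟩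
  · rw [Matrix.det_smul, Matrix.det_fin_two_of, Fintype.card_fin]
    field_simp
    rw [pow_two, ← hk]
    simp only [bracket]
    ring
  · positivity
  · exact neg_ne_zero.2 (by positivity)
  · exact neg_ne_zero.2 (by positivity)
  all_goals
    simp only [bracket]
    ext i
    fin_cases i <;> simp [Matrix.mulVec, dotProduct, Fin.sum_univ_two] <;> ring

theorem isClassOf_of_eq_smul {S : SL2C} {k : ℂ} {A : Matrix (Fin 2) (Fin 2) ℂ} (h : S.1 = k • A) :
    IsClassOf (S : PSL2C) A := by
  refine ⟨S, k, ?_, rfl, h⟩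
  rintro rfl
  have := S.2
  rw [h, zero_smul, Matrix.det_zero] at this
  exact zero_ne_one this

theorem mulVec_fin_two (S : Matrix (Fin 2) (Fin 2) ℂ) (x y : ℂ) :
    S.mulVec ![x, y] = ![S 0 0 * x + S 0 1 * y, S 1 0 * x + S 1 1 * y] := by
  ext i
  fin_cases i <;> simp [Matrix.mulVec, dotProduct, Fin.sum_univ_two]

/-- A projective transformation is determined by the images of `∞`, `0`, `1`; here `∞` and `0` are
exchanged and `1` is fixed. -/
theorem isClassOf_edge₁ {S : SL2C} {α β γ α' β' γ' : ℂ} (hα : α ≠ 0) (hβ : β ≠ 0) (hγ : γ ≠ 0)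
    (ha : S.1.mulVec ![α, 0] = ![0, β']) (hb : S.1.mulVec ![0, β] = ![α', 0])
    (hc : S.1.mulVec ![γ, γ] = ![γ', γ']) : IsClassOf (S : PSL2C) !![0, 1; 1, 0] := by
  simp only [mulVec_fin_two, Matrix.vecCons_inj, mul_zero, add_zero, zero_add, mul_eq_zero,
    hα, hβ, or_false, and_true] at ha hb hc
  refine isClassOf_of_eq_smul (k := S.1 0 1) ?_
  have h : S.1 1 0 = S.1 0 1 := by
    refine mul_right_cancel₀ hγ ?_
    linear_combination hc.2 - hc.1 + γ * ha.1 - γ * hb.2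
  ext i j
  fin_cases i <;> fin_cases j <;> simp [ha.1, hb.2, h]

theorem isClassOf_edge₂ {S : SL2C} {α β γ α' β' γ' : ℂ} (hα : α ≠ 0) (hβ : β ≠ 0) (hγ : γ ≠ 0)
    (ha : S.1.mulVec ![α, 0] = ![α', 0]) (hb : S.1.mulVec ![0, β] = ![γ', γ'])
    (hc : S.1.mulVec ![γ, γ] = ![0, β']) : IsClassOf (S : PSL2C) !![1, -1; 0, -1] := by
  simp only [mulVec_fin_two, Matrix.vecCons_inj, mul_zero, add_zero, zero_add, mul_eq_zero,
    hα, or_false, and_true] at ha hb hc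
  have h₁ : S.1 0 1 = -S.1 0 0 := by
    refine mul_right_cancel₀ hγ ?_
    linear_combination hc.1
  have h₂ : S.1 1 1 = -S.1 0 0 := by
    rw [← h₁]
    exact mul_right_cancel₀ hβ (hb.2.trans hb.1.symm)
  refine isClassOf_of_eq_smul (k := S.1 0 0) ?_
  ext i j
  fin_cases i <;> fin_cases j <;> simp [ha.2, h₁, h₂]

/-- The matrix is diagonal since `∞` and `0` are fixed. The ratio of its entries is the coordinate
of the line sent to `1`, which `hx` expresses as a cross-ratio through brackets. -/
theorem isClassOf_edge₃ {S : SL2C} {x α β γ α' β' γ' : ℂ} {v : Fin 2 → ℂ} (hα : α ≠ 0) (hβ : β ≠ 0)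
    (hγ : γ ≠ 0) (hγ' : γ' ≠ 0) (ha : S.1.mulVec ![α, 0] = ![α', 0])
    (hb : S.1.mulVec ![0, β] = ![0, β']) (hv : S.1.mulVec v = ![γ', γ'])
    (hx : x * (bracket ![0, β] ![γ, γ] * bracket ![α, 0] v) =
      bracket ![α, 0] ![γ, γ] * bracket ![0, β] v) :
    IsClassOf (S : PSL2C) !![1, 0; 0, x] := by
  have e₁ := bracket_mulVec S ![α, 0] v
  have e₂ := bracket_mulVec S ![0, β] v
  rw [ha, hv] at e₁
  rw [hb, hv] at e₂
  simp only [mulVec_fin_two, Matrix.vecCons_inj, mul_zero, add_zero, zero_add, mul_eq_zero,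
    hα, hβ, or_false, and_true] at ha hb
  rw [← e₁, ← e₂, ← ha.1, ← hb.2] at hx
  simp only [bracket, Matrix.cons_val_zero, Matrix.cons_val_one] at hx
  have h : S.1 1 1 = S.1 0 0 * x := by
    refine mul_right_cancel₀ (mul_ne_zero (mul_ne_zero (mul_ne_zero hα hβ) hγ) hγ') ?_
    linear_combination hx
  refine isClassOf_of_eq_smul (k := S.1 0 0) ?_
  ext i j
  fin_cases i <;> fin_cases j <;> simp [ha.2, hb.1, h]

/-- The triple obtained from `t` by a change of trivialization of the bundle. -/
def FlatTriple.gauge {M : Type*} [TopologicalSpace M] {B : Set M} (t : FlatTriple M B)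
    (g : M → SL2C) : FlatTriple M B where
  P :=
    { hol := fun {p q} γ => (g q : PSL2C) * t.P.hol γ * (g p : PSL2C)⁻¹
      hol_trans := fun γ δ => by rw [t.P.hol_trans]; group }
  s p := (g p : PSL2C) • t.s p
  s_flat γ := by rw [mul_smul, mul_smul, inv_smul_smul, t.s_flat]
  l := t.l
  l_trans := t.l_trans
  l_conj := t.l_conj
  exists_lift := by
    obtain ⟨P', lift, hl⟩ := t.exists_lift
    refine ⟨{ hol := fun {p q} γ => g q * P'.hol γ * (g p)⁻¹
              hol_trans := fun γ δ => by rw [P'.hol_trans]; group }, fun {p q} γ => ?_,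
            fun {p} γ v hv => ?_⟩
    · change ((g q * P'.hol γ * (g p)⁻¹ : SL2C) : PSL2C) = _ * t.P.hol γ * _
      rw [← lift γ]
      rfl
    · have h := hl γ (t.s p).rep
        (by rw [Projectivization.submodule_eq]; exact Submodule.mem_span_singleton_self _)
      rw [← Projectivization.mk_rep (t.s p), CP1.smul_mk _ _ _
        (SL2C.mulVec_ne_zero _ (Projectivization.rep_nonzero _)), Projectivization.submodule_mk,
        Submodule.mem_span_singleton] at hv
      obtain ⟨c, rfl⟩ := hv
      rw [Matrix.mulVec_smul, Matrix.mulVec_mulVec, ← Matrix.SpecialLinearGroup.coe_mul,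
        inv_mul_cancel_right, Matrix.SpecialLinearGroup.coe_mul, ← Matrix.mulVec_mulVec, h,
        Matrix.mulVec_smul, smul_comm]

theorem FlatTriple.equivalent_gauge {M : Type*} [TopologicalSpace M] {B : Set M}
    (t : FlatTriple M B) (g : M → SL2C) : t.Equivalent (t.gauge g) :=
  ⟨fun p => g p, fun _ => rfl, fun _ => rfl, fun _ => rfl⟩

/-! ### Cross-ratio relations and the normalized triple -/

namespace FlatTriple.LogSection

open AbstractTriangulation OrderedTet

variable {I : Type*} {T : AbstractTriangulation I} {M : Type*} [TopologicalSpace M] {B : Set M}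
  {t : FlatTriple M B} (S : t.LogSection) (τ : T.Triangulates M B) (b : T.Branching)

theorem bracket_edgeVertex_ne_zero (h₀ : ∀ o, S.edgeBracket τ o ≠ 0) (o : OrderedTet I)
    (q : truncTet) :
    bracket (S.transp τ o.1 q o.edgeVertex) (S.transp τ o.1 q o.swap₁.edgeVertex) ≠ 0 := by
  rw [← edgeBracket_eq]
  exact h₀ o

/-- Moving around a corner multiplies its vector by a nonzero scalar, so the vanishing of a bracket
depends on the two lines only. -/
theorem bracket_edgeVertex_swap₂_ne_zero (h₀ : ∀ o, S.edgeBracket τ o ≠ 0) (o : OrderedTet I)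
    (q : truncTet) :
    bracket (S.transp τ o.1 q o.edgeVertex) (S.transp τ o.1 q o.swap₂.swap₁.edgeVertex) ≠ 0 := by
  rw [S.transp_eq_smul τ o.1 o.edgeVertex o.swap₂.edgeVertex q (o.2 0) o.edgeVertex_apply_zero
    o.edgeVertex_swap₂_apply, bracket_smul_left]
  exact mul_ne_zero (Complex.exp_ne_zero _) (S.bracket_edgeVertex_ne_zero τ h₀ o.swap₂ q)

theorem bracket_edgeVertex_swap₁_swap₂_ne_zero (h₀ : ∀ o, S.edgeBracket τ o ≠ 0) (o : OrderedTet I)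
    (q : truncTet) : bracket (S.transp τ o.1 q o.swap₁.edgeVertex)
      (S.transp τ o.1 q o.swap₂.swap₁.edgeVertex) ≠ 0 := by
  rw [S.transp_eq_smul τ o.1 o.swap₂.swap₁.edgeVertex o.swap₁.swap₂.swap₁.edgeVertex q
    (o.swap₂.swap₁.2 0) (edgeVertex_apply_zero _)
    (by rw [swap₁_swap₂_swap₁]; exact edgeVertex_swap₂_apply _), bracket_smul_right]
  exact mul_ne_zero (Complex.exp_ne_zero _) (S.bracket_edgeVertex_swap₂_ne_zero τ h₀ o.swap₁ q)

/-- The exponentials of the flattening are cross-ratios of the lines of the section. -/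
theorem exp_faceLog_sub (h₀ : ∀ o, S.edgeBracket τ o ≠ 0) (o : OrderedTet I) (q : truncTet) :
    Complex.exp (2 * (S.faceLog τ b o - S.faceLog τ b o.swap₃)) *
      (bracket (S.transp τ o.1 q o.swap₁.edgeVertex) (S.transp τ o.1 q o.swap₂.swap₁.edgeVertex) *
        bracket (S.transp τ o.1 q o.edgeVertex) (S.transp τ o.1 q o.swap₃.swap₂.swap₁.edgeVertex)) =
      bracket (S.transp τ o.1 q o.edgeVertex) (S.transp τ o.1 q o.swap₂.swap₁.edgeVertex) *
      bracket (S.transp τ o.1 q o.swap₁.edgeVertex)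
        (S.transp τ o.1 q o.swap₃.swap₂.swap₁.edgeVertex) := by
  have h₁ := S.exp_two_mul_faceLog τ b h₀ o q
  have h₂ := S.exp_two_mul_faceLog τ b h₀ o.swap₃ q
  rw [edgeVertex_swap₃_swap₁, edgeVertex_swap₃, swap₃_fst] at h₂
  have n := S.bracket_edgeVertex_ne_zero τ h₀ o q
  have e := Complex.exp_ne_zero (2 * S.faceLog τ b o.swap₃)
  rw [mul_sub, Complex.exp_sub, div_mul_eq_mul_div, div_eq_iff e]
  refine mul_left_cancel₀ (mul_ne_zero Complex.I_ne_zero n) ?_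
  linear_combination
    Complex.I * bracket (S.transp τ o.1 q o.edgeVertex) (S.transp τ o.1 q o.swap₁.edgeVertex) *
      bracket (S.transp τ o.1 q o.edgeVertex) (S.transp τ o.1 q o.swap₃.swap₂.swap₁.edgeVertex) * h₁ -
    Complex.I * bracket (S.transp τ o.1 q o.edgeVertex) (S.transp τ o.1 q o.swap₁.edgeVertex) *
      bracket (S.transp τ o.1 q o.edgeVertex) (S.transp τ o.1 q o.swap₂.swap₁.edgeVertex) * h₂

/-- With the exponentials written as cross-ratios and denominators cleared, this is Plücker's
identity for the four lines. -/
theorem exp_faceLog_sub_swap₂ (h₀ : ∀ o, S.edgeBracket τ o ≠ 0) (o : OrderedTet I) :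
    Complex.exp (2 * (S.faceLog τ b o.swap₂ - S.faceLog τ b o.swap₂.swap₃)) =
      1 - Complex.exp (2 * (S.faceLog τ b o - S.faceLog τ b o.swap₃)) := by
  obtain ⟨q⟩ : Nonempty truncTet := ⟨polyVertex 1⟩
  have h₁ := S.exp_faceLog_sub τ b h₀ o q
  have h₂ := S.exp_faceLog_sub τ b h₀ o.swap₂ q
  have hd : o.swap₂.swap₃.swap₂.swap₁.edgeVertex = o.swap₃.swap₂.swap₁.edgeVertex := by
    rw [swap₂_swap₃_swap₂, edgeVertex_swap₃_swap₁]
  have ha := S.transp_eq_smul τ o.1 o.edgeVertex o.swap₂.edgeVertex q (o.2 0)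
    o.edgeVertex_apply_zero o.edgeVertex_swap₂_apply
  rw [swap₂_swap₂, swap₂_fst, hd] at h₂
  have n₁ := S.bracket_edgeVertex_swap₁_swap₂_ne_zero τ h₀ o q
  have n₂ := S.bracket_edgeVertex_swap₂_ne_zero τ h₀ o.swap₃ q
  rw [edgeVertex_swap₃, swap₃_fst] at n₂
  have pl := bracket_plucker (S.transp τ o.1 q o.edgeVertex)
    (S.transp τ o.1 q o.swap₁.edgeVertex) (S.transp τ o.1 q o.swap₂.swap₁.edgeVertex)
    (S.transp τ o.1 q o.swap₃.swap₂.swap₁.edgeVertex)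
  have sw := bracket_swap (S.transp τ o.1 q o.swap₁.edgeVertex)
    (S.transp τ o.1 q o.swap₂.swap₁.edgeVertex)
  -- The formula for `xzyt` uses the vector of `x` taken at the edge `xz`; this factor replaces it
  -- by the one at `xy`.
  have h₂' := congrArg (Complex.exp (S.segLog τ o.1 o.edgeVertex o.swap₂.edgeVertex (o.2 0)
    o.edgeVertex_apply_zero o.edgeVertex_swap₂_apply) * ·) h₂
  simp only [← mul_assoc] at h₂'
  have k₁ := bracket_smul_left (Complex.exp (S.segLog τ o.1 o.edgeVertex o.swap₂.edgeVertex (o.2 0)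
    o.edgeVertex_apply_zero o.edgeVertex_swap₂_apply)) (S.transp τ o.1 q o.swap₂.edgeVertex)
    (S.transp τ o.1 q o.swap₁.edgeVertex)
  have k₂ := bracket_smul_left (Complex.exp (S.segLog τ o.1 o.edgeVertex o.swap₂.edgeVertex (o.2 0)
    o.edgeVertex_apply_zero o.edgeVertex_swap₂_apply)) (S.transp τ o.1 q o.swap₂.edgeVertex)
    (S.transp τ o.1 q o.swap₃.swap₂.swap₁.edgeVertex)
  rw [← ha] at k₁ k₂
  rw [← k₁] at h₂'
  refine mul_right_cancel₀ (mul_ne_zero n₁ n₂) ?_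
  rw [sw] at h₂'
  linear_combination -h₂' + h₁ - pl + Complex.exp (2 * (S.faceLog τ b o.swap₂ -
    S.faceLog τ b o.swap₂.swap₃)) * bracket (S.transp τ o.1 q o.swap₁.edgeVertex)
      (S.transp τ o.1 q o.swap₂.swap₁.edgeVertex) * k₂

/-- `g` is the matrix of a frame of the fibre over the vertex `xyzt` in which the lines of the section
around `x`, `y` and `z` are `∞`, `0` and `1`. -/
def IsFrame (o : OrderedTet I) (g : SL2C) : Prop :=
  ∃ α β γ : ℂ, α ≠ 0 ∧ β ≠ 0 ∧ γ ≠ 0 ∧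
    g.1.mulVec (S.transp τ o.1 (polyVertex o.2) o.edgeVertex) = ![α, 0] ∧
    g.1.mulVec (S.transp τ o.1 (polyVertex o.2) o.swap₁.edgeVertex) = ![0, β] ∧
    g.1.mulVec (S.transp τ o.1 (polyVertex o.2) o.swap₂.swap₁.edgeVertex) = ![γ, γ]

/-- A frame involves only the lines of `x`, `y`, `z`, all of which can be compared inside the face
`xyz`. -/
theorem isFrame_cross (o : OrderedTet I) (g : SL2C) :
    S.IsFrame τ (T.cross o) g ↔ S.IsFrame τ o g := by
  unfold IsFrame
  rw [S.transp_cross τ (crossing_edgeVertex o) (crossing_polyVertex o),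
    S.transp_cross τ (crossing_edgeVertex_swap₁ o) (crossing_polyVertex o),
    S.transp_cross τ (crossing_edgeVertex_swap₂_swap₁ o) (crossing_polyVertex o)]

theorem exists_gauge (h₀ : ∀ o, S.edgeBracket τ o ≠ 0) :
    ∃ g : M → SL2C, ∀ o, S.IsFrame τ o (g (τ.vert o)) := by
  have hex : ∀ o, ∃ g, S.IsFrame τ o g := fun o =>
    exists_frame (S.bracket_edgeVertex_ne_zero τ h₀ o _) (S.bracket_edgeVertex_swap₂_ne_zero τ h₀ o _)
      (S.bracket_edgeVertex_swap₁_swap₂_ne_zero τ h₀ o _)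
  -- The whole set of frames descends to a function on `M`; choosing afterwards gives identified
  -- vertices the same frame.
  obtain ⟨K, hK⟩ := τ.exists_point_fun (fun o => {g | S.IsFrame τ o g}) fun o => by
    ext g
    exact S.isFrame_cross τ o g
  choose! F hF using fun m (h : (K m).Nonempty) => h
  refine ⟨F, fun o => ?_⟩
  have := hF (τ.vert o) (by rw [hK]; exact hex o)
  rwa [hK] at this

/-- The logarithm of the path from the edge `xy` to the vertex `xyzt`. -/
def vertLog (o : OrderedTet I) : ℂ :=
  S.segLog τ o.1 o.edgeVertex (polyVertex o.2) (o.2 0) o.edgeVertex_apply_zero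
    (polyVertex_apply_zero o.2)

theorem vertLog_cross (o : OrderedTet I) : S.vertLog τ (T.cross o) = S.vertLog τ o :=
  S.segLog_cross τ (crossing_edgeVertex o) (crossing_polyVertex o) _ _ _ _ _ _

theorem lam_edge₂ (o : OrderedTet I) : S.lam (Path.Homotopic.Quotient.mk (τ.edge₂ o)) =
    S.turnLog τ o + S.vertLog τ o.swap₂ - S.vertLog τ o := by
  have hp : o.swap₂.edgeVertex.1 (o.2 0) = 2 / 3 := o.edgeVertex_swap₂_apply
  have hq : (polyVertex o.swap₂.2).1 (o.2 0) = 2 / 3 := by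
    simpa using polyVertex_apply_zero o.swap₂.2
  have e : S.vertLog τ o.swap₂ = S.segLog τ o.1 o.swap₂.edgeVertex (polyVertex o.swap₂.2) (o.2 0)
      hp hq := S.segLog_congr τ _ _ _ _ _ rfl rfl (by simp)
  have e' : S.lam (Path.Homotopic.Quotient.mk (τ.edge₂ o)) =
    S.segLog τ o.1 (polyVertex o.2) (polyVertex o.swap₂.2) (o.2 0) (polyVertex_apply_zero o.2) hq := rfl
  rw [e, e', turnLog, segLog_trans, eq_sub_iff_add_eq', vertLog, segLog_trans]

theorem lam_edge₃ (o : OrderedTet I) : S.lam (Path.Homotopic.Quotient.mk (τ.edge₃ o)) =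
    S.vertLog τ o.swap₃ - S.vertLog τ o := by
  have hq : (polyVertex o.swap₃.2).1 (o.2 0) = 2 / 3 := by
    simpa using polyVertex_apply_zero o.swap₃.2
  have e : S.vertLog τ o.swap₃ = S.segLog τ o.1 o.edgeVertex (polyVertex o.swap₃.2) (o.2 0)
      o.edgeVertex_apply_zero hq := S.segLog_congr τ _ _ _ _ _ o.edgeVertex_swap₃ rfl (by simp)
  have e' : S.lam (Path.Homotopic.Quotient.mk (τ.edge₃ o)) =
    S.segLog τ o.1 (polyVertex o.2) (polyVertex o.swap₃.2) (o.2 0) (polyVertex_apply_zero o.2) hq := rfl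
  rw [e, e', eq_sub_iff_add_eq', vertLog, segLog_trans]

variable {b}

theorem l_eq_of_bdryWalk {X : T.CrossRatioStructure} (F : T.Flattening b X)
    (hF : ∀ o, F.L o = 2 * (S.faceLog τ b o - S.faceLog τ b o.swap₃)) {p : B}
    (γ : Path.Homotopic.Quotient p p) (z : ℂ) (h : BdryWalk τ F γ z) : t.l γ = z := by
  -- Along an edge of either type, the prescribed logarithm minus `lam` is the increment of `faceLog
  -- - vertLog`, which is well defined on points of `M`.
  obtain ⟨K, hK⟩ := τ.exists_point_fun (fun o => S.faceLog τ b o - S.vertLog τ o) fun o => by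
    rw [faceLog_cross, vertLog_cross]
  have key : ∀ {p q : B} (γ : Path.Homotopic.Quotient p q) (z : ℂ), BdryWalk τ F γ z →
      z = S.lam γ + K q - K p := by
    intro p q γ z h
    induction h with
    | refl => simp
    | step₂ o _ ih =>
      rw [S.lam_trans, lam_edge₂, ih, hK, hK]
      linear_combination -S.faceLog_swap₂_sub τ b o
    | step₃ o _ ih =>
      rw [S.lam_trans, lam_edge₃, ih, hK, hK, hF]
      ring
  rw [key γ z h, add_sub_cancel_right, S.lam_loop]

/-- The matrix of the holonomy along a segment from `p` to `q` in frames at its ends. -/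
theorem gauge_mulVec (g g' : SL2C) (i : I) (p q r : truncTet) :
    (g' * S.segHol τ i p q * g⁻¹).1.mulVec (g.1.mulVec (S.transp τ i p r)) =
      g'.1.mulVec (S.transp τ i q r) := by
  rw [Matrix.mulVec_mulVec, ← Matrix.SpecialLinearGroup.coe_mul, inv_mul_cancel_right,
    Matrix.SpecialLinearGroup.coe_mul, ← Matrix.mulVec_mulVec, segHol_mulVec_transp]

theorem gauge_hol (g : M → SL2C) (i : I) (p q : truncTet) :
    (t.gauge g).P.hol (Path.Homotopic.Quotient.mk (τ.seg i p q)) =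
      ((g (τ.h (T.pt i q)) * S.segHol τ i p q * (g (τ.h (T.pt i p)))⁻¹ : SL2C) : PSL2C) := by
  change _ * t.P.hol _ * _ = _
  rw [← S.lift]
  rfl

theorem isCocycleOf_gauge (h₀ : ∀ o, S.edgeBracket τ o ≠ 0) {g : M → SL2C}
    (hg : ∀ o, S.IsFrame τ o (g (τ.vert o))) {X : T.CrossRatioStructure} (F : T.Flattening b X)
    (hF : ∀ o, F.L o = 2 * (S.faceLog τ b o - S.faceLog τ b o.swap₃)) :
    IsCocycleOf τ F (t.gauge g) where
  s_vert o := by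
    obtain ⟨α, -, -, hα, -, -, ha, -⟩ := hg o
    have e := S.transp_eq_smul τ o.1 (polyVertex o.2) o.edgeVertex (polyVertex o.2) (o.2 0)
      (polyVertex_apply_zero o.2) o.edgeVertex_apply_zero
    rw [S.transp_self τ o.1 (polyVertex o.2) (o.2 0) (polyVertex_apply_zero o.2)] at e
    have hu : (g (τ.vert o)).1.mulVec (S.u (τ.vert o)) = _ := congrArg (g (τ.vert o)).1.mulVec e
    rw [Matrix.mulVec_smul, ha] at hu
    change (g (τ.vert o) : PSL2C) • t.s (τ.vert o) = _
    rw [← S.mk_u, CP1.smul_mk _ _ _ (SL2C.mulVec_ne_zero _ (S.u_ne_zero _)), CP1.infty]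
    refine mk_eq_mk_of_bracket_eq_zero _ _ ?_
    rw [hu]
    simp [bracket]
  hol_edge₁ o := by
    obtain ⟨α, β, γ, hα, hβ, hγ, ha, hb, hc⟩ := hg o
    obtain ⟨α', β', γ', -, -, -, ha', hb', hc'⟩ := hg o.swap₁
    have e := S.gauge_hol τ g o.1 (polyVertex o.2) (polyVertex o.swap₁.2)
    have key := S.gauge_mulVec τ (g (τ.vert o)) (g (τ.vert o.swap₁)) o.1 (polyVertex o.2)
      (polyVertex o.swap₁.2)
    -- The line of `z` is represented by its vector at `zx` in the first frame and at `zy` in the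
    -- second one.
    have sc := S.transp_eq_smul τ o.1 o.swap₂.swap₁.edgeVertex o.swap₁.swap₂.swap₁.edgeVertex
      (polyVertex o.swap₁.2) (o.swap₂.swap₁.2 0) (edgeVertex_apply_zero _)
      (by rw [swap₁_swap₂_swap₁]; exact edgeVertex_swap₂_apply _)
    rw [swap₁_swap₁] at hb'
    have k₁ := key o.edgeVertex
    have k₂ := key o.swap₁.edgeVertex
    have k₃ := key o.swap₂.swap₁.edgeVertex
    rw [ha] at k₁
    rw [hb] at k₂
    rw [hc, sc, Matrix.mulVec_smul] at k₃
    have k₃' := k₃.trans ((congrArg _ hc').trans (Matrix.smul_vec2 _ _ _))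
    exact e ▸ isClassOf_edge₁ hα hβ hγ (k₁.trans hb') (k₂.trans ha') k₃'
  hol_edge₂ o := by
    obtain ⟨α, β, γ, hα, hβ, hγ, ha, hb, hc⟩ := hg o
    obtain ⟨α', β', γ', -, -, -, ha', hb', hc'⟩ := hg o.swap₂
    have e := S.gauge_hol τ g o.1 (polyVertex o.2) (polyVertex o.swap₂.2)
    have key := S.gauge_mulVec τ (g (τ.vert o)) (g (τ.vert o.swap₂)) o.1 (polyVertex o.2)
      (polyVertex o.swap₂.2)
    have sc := S.transp_eq_smul τ o.1 o.edgeVertex o.swap₂.edgeVertex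
      (polyVertex o.swap₂.2) (o.2 0) (edgeVertex_apply_zero _) o.edgeVertex_swap₂_apply
    rw [swap₂_swap₂] at hc'
    have k₁ := key o.edgeVertex
    have k₂ := key o.swap₁.edgeVertex
    have k₃ := key o.swap₂.swap₁.edgeVertex
    rw [ha, sc, Matrix.mulVec_smul] at k₁
    rw [hb] at k₂
    rw [hc] at k₃
    have k₁' := k₁.trans ((congrArg _ ha').trans (Matrix.smul_vec2 _ _ _))
    rw [smul_zero] at k₁'
    exact e ▸ isClassOf_edge₂ hα hβ hγ k₁' (k₂.trans hc') (k₃.trans hb')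
  hol_edge₃ o := by
    obtain ⟨α, β, γ, hα, hβ, hγ, ha, hb, hc⟩ := hg o
    obtain ⟨α', β', γ', -, -, hγ', ha', hb', hc'⟩ := hg o.swap₃
    have e := S.gauge_hol τ g o.1 (polyVertex o.2) (polyVertex o.swap₃.2)
    have key := S.gauge_mulVec τ (g (τ.vert o)) (g (τ.vert o.swap₃)) o.1 (polyVertex o.2)
      (polyVertex o.swap₃.2)
    rw [edgeVertex_swap₃] at ha'
    rw [edgeVertex_swap₃_swap₁] at hb'
    have k₁ := key o.edgeVertex
    have k₂ := key o.swap₁.edgeVertex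
    have k₃ := key o.swap₃.swap₂.swap₁.edgeVertex
    -- The cross-ratio identity at the vertex `xyzt`, next rewritten in the coordinates of the frame
    -- there.
    have hx := S.exp_faceLog_sub τ b h₀ o (polyVertex o.2)
    rw [← hF, F.exp_L] at hx
    simp only [← bracket_mulVec (g (τ.vert o)) (S.transp τ _ _ _)] at hx
    rw [ha, hb, hc] at hx
    rw [ha] at k₁
    rw [hb] at k₂
    exact e ▸ isClassOf_edge₃ hα hβ hγ hγ' (k₁.trans ha') (k₂.trans hb') (k₃.trans hc') hx
  l_walk γ z h := S.l_eq_of_bdryWalk τ F hF γ z h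

end FlatTriple.LogSection

end

/-! ### The proposition -/

theorem mainTheorem7 {I : Type*} [Finite I] (T : AbstractTriangulation I)
    {M : Type*} [TopologicalSpace M] {B : Set M} (τ : T.Triangulates M B) (b : T.Branching)
    (r : RSet M B)
    (hr : ∀ (i : I) (x y : Fin 4) (hxy : x ≠ y), r.Regular (τ.interiorEdge i x y hxy)) :
    ∃ (X : T.CrossRatioStructure) (L : T.Flattening b X),
      AbstractTriangulation.IsPhi τ X L r := by
  obtain ⟨t, rfl⟩ := Quotient.exists_rep r
  obtain ⟨S⟩ := t.exists_logSection
  have h₀ := S.edgeBracket_ne_zero τ hr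
  obtain ⟨X, F, hF⟩ := AbstractTriangulation.exists_flattening (S.turnLog_swap₂ τ) (S.turnLog_rot τ)
    (S.turnLog_cross τ) (S.edgeLog_swap₁ τ b) (S.edgeLog_swap₃ τ b) (S.edgeLog_cross τ b)
    (k := S.faceLog τ b) rfl (S.exp_faceLog_sub_swap₂ τ b h₀)
  obtain ⟨g, hg⟩ := S.exists_gauge τ h₀
  exact ⟨X, F, t.gauge g, S.isCocycleOf_gauge τ h₀ hg F hF,
    Quotient.sound (t.equivalent_gauge g).symm⟩
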